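/- **Setting.** Let $I$ be a finite nonempty set of players, $A_i$ finite nonempty action sets, $A=\prod_i A_i$, $A_{-i}=\prod_{j\ne i}A_j$, and $u_i:A\to\mathbb R$ payoffs. $\Delta_i$ is the simplex over $A_i$, $\Delta=\prod_i\Delta_i$, and $U_i(\pi)=\mathbb E_{a\sim\pi}[u_i(a)]$ for $\pi\in\Delta$. For $M\ge 1$, $\Delta_j^M\subset\Delta_j$ is the set of distributions with all probabilities in $\{0,\frac1M,\dots,1\}$. A belief of player $i$ is $b_i=(b_{ij})_{j\neq i}\in\mathcal B_i=\prod_{j\ne i}\Delta_j^M$, read as independent play of the opponents. For $\sigma>0$ the smooth best response is $\mathrm{Br}_i^\sigma(b_i)(a_i)=e^{U_i(a_i,b_i)/\sigma}/\sum_{a_i'}e^{U_i(a_i',b_i)/\sigma}$. The states are $\mathcal Z=\{z=(b,\pi): b_i\in\mathcal B_i,\ \pi_i=\mathrm{Br}^\sigma_i(b_i)\ \forall i\}$. For $\tau>0$, with $\|\cdot\|_2$ the Euclidean norm of the concatenated vector $(\pi_j-b_{ij})_{j\neq i}$, the consistent states are $\mathcal Z^\dagger=\{(b,\pi)\in\mathcal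 Z:\ \|b_i-\pi_{-i}\|_2\le\tau\ \forall i\}$. **Learning dynamics.** Fix $\gamma_i\in(0,1]$; strictly increasing $f_i:\mathbb R\to\mathbb R_{>0}$; a constant $H$ with $H>\sum_i f_i(U_i(\pi))$ for all $\pi\in\Delta$; resampling kernels $\psi_i(\cdot\mid b_i)$ on $\mathcal B_i$ with $\psi_i(b_i'\mid b_i)\ge\lambda>0$; and, for each $\alpha\in(0,1)$, a sample size $T(\alpha)\ge1$ with $T(\alpha)\ge\frac{2|A_{-i}|}{(\|\pi_{-i}-b_i\|_2-\tau)^2}\ln\frac2\alpha$ for all $i$, all $b_i\in\mathcal B_i$ and all profiles $\pi_{-i}$ of smooth best responses of the opponents to beliefs with $\|\pi_{-i}-b_i\|_2>\tau$. For $\xi\in(0,1)$ put $\alpha=\xi^{H}$, $T=T(\alpha)$. In an epoch in state $(b,\pi)$ the profile $\pi$ is played independently $T$ times, and all players observe the play. Then, independently across players, player $i$ tests with probability $\gamma_i$. A testing player rejects iff $\|\hat\pi_{-i}-b_i\|_2>\tau+\sqrt{\frac{|A_{-i}|}{2T}\ln\frac2\alpha}$, where $\hat\pi_{-i}=(\hat\pi_j)_{j\ne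 i}$ are the opponents' empirical action frequencies. On rejection $i$ resamples a belief from $\psi_i(\cdot\mid b_i)$; if the test does not reject, $i$ resamples from $\psi_i(\cdot\mid b_i)$ with probability $\xi^{f_i(U_i(\pi_i,b_i))}$. In all other cases $i$ keeps $b_i$. Strategies are then updated to $\mathrm{Br}^\sigma$ of the new beliefs. Let $P^\xi$ be the resulting transition matrix on $\mathcal Z$. **Assumptions.** (A1) For some $\varepsilon>0$, with $\bar m=\max_i|A_i|$, $\bar v=\max_{i,a}|u_i(a)|$ and $N=\max_i|A_i||A_{-i}|$, $$\sigma\le\frac{\varepsilon}{2\log\bar m},\qquad \tau\le\frac{\varepsilon\sigma}{2\sqrt{|A|}\,\bar v\,N},\qquad M\ge\frac{|I|\,\bar m}{\tau}\Bigl(1+\frac{\sqrt{\bar m}}{\sigma}\,\bar v\,N\,|I|\Bigr),$$ where a bound with denominator $0$ is no restriction. (A2) For every player $i$, all beliefs $(b_j)_{j\ne i}$ and $\pi_{-i}=(\mathrm{Br}_j^\sigma(b_j))_{j\neq i}$, there is $\tilde b_i\in\mathcal B_i$ with $\|\tilde b_i-\pi_{-i}\|_2>\tau$ and $\|\mathrm{Br}_i^\sigma(\tilde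 b_i)-b_{ji}\|_2>\tau$ for all $j\ne i$. **Corollary.** Assume (A1) and (A2). For every $\xi\in(0,1)$, $P^\xi$ has a unique stationary distribution $\mu^\xi$, and $\lim_{\xi\to0^+}\mu^\xi_z$ exists for all $z\in\mathcal Z$. Let $\mathcal Z^*=\{z\in\mathcal Z:\lim_{\xi\to0^+}\mu_z^\xi>0\}$ be the set of stochastically stable states. Let $\underline u_i$ and $\overline u_i$ be the minimum and maximum of $U_i(\pi_i,b_i)$ over $\mathcal Z$. (i) If $f_i(x)=f_j(x)$ for all $i,j\in I$ and all $x\in[\min_k\underline u_k,\max_k\overline u_k]$, then $$\mathcal Z^*=\Bigl\{(b,\pi)\in\mathcal Z^\dagger:\ \min_{i}U_i(\pi_i,b_i)=\max_{(b',\pi')\in\mathcal Z^\dagger}\min_{i}U_i(\pi_i',b_i')\Bigr\}.$$ (ii) If $\hat\imath\in I$ is a player such that $f_{\hat\imath}(x)\le f_j(y)$ for all $j\ne\hat\imath$, $x\in[\underline u_{\hat\imath},\overline u_{\hat\imath}]$ and $y\in[\underline u_j,\overline u_j]$, then $$\mathcal Z^*=\Bigl\{(b,\pi)\in\mathcal Z^\dagger:\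 U_{\hat\imath}(\pi_{\hat\imath},b_{\hat\imath})=\max_{(b',\pi')\in\mathcal Z^\dagger}U_{\hat\imath}(\pi'_{\hat\imath},b'_{\hat\imath})\Bigr\}.$$ -/

import Mathlib

open Filter Topology

noncomputable section

namespace HypothesisTesting

/-! ### The game, beliefs and smooth best responses

`I` is the set of players, `A i` the set of actions of player `i`, `u i a` the payoff of player `i`
at the action profile `a`. The opponents of `i` are indexed by `{j // j ≠ i}`. -/

/-- The Euclidean distance of two real vectors. -/
def l2Dist {ι : Type*} [Fintype ι] (p q : ι → ℝ) : ℝ :=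
  dist (WithLp.toLp 2 p : EuclideanSpace ℝ ι) (WithLp.toLp 2 q)

/-- The Euclidean distance of two families of real vectors, each family being read as one long
vector (the concatenation of its members). -/
def profileDist {κ : Type*} [Fintype κ] {B : κ → Type*} [∀ k, Fintype (B k)]
    (p q : ∀ k, B k → ℝ) : ℝ :=
  l2Dist (fun x : (Σ k, B k) => p x.1 x.2) (fun x : (Σ k, B k) => q x.1 x.2)

/-- The profile with entry `x` at `i` and entries `y` at the other indices. -/
def joinAt {I : Type*} [DecidableEq I] {β : I → Type*} (i : I) (x : β i)
    (y : ∀ j : {j // j ≠ i}, β j) : ∀ j, β j :=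
  (Equiv.piSplitAt i β).symm (x, y)

/-- The discretized simplex: probability vectors with all entries in `{m / M : m = 0, …, M}`. -/
def DiscreteSimplex (α : Type*) [Fintype α] (M : ℕ) : Type _ :=
  {p : α → ℝ // p ∈ stdSimplex ℝ α ∧ ∀ a, ∃ m : ℕ, m ≤ M ∧ p a = (m : ℝ) / (M : ℝ)}

instance DiscreteSimplex.instFinite (α : Type*) [Fintype α] (M : ℕ) :
    Finite (DiscreteSimplex α M) := by
  have hfin : ({x : ℝ | ∃ m : ℕ, m ≤ M ∧ x = (m : ℝ) / (M : ℝ)}).Finite := by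
    refine ((Set.finite_Iic M).image (fun m : ℕ => (m : ℝ) / (M : ℝ))).subset ?_
    rintro x ⟨m, hm, rfl⟩
    exact ⟨m, hm, rfl⟩
  have h : ({p : α → ℝ | p ∈ stdSimplex ℝ α ∧
      ∀ a, ∃ m : ℕ, m ≤ M ∧ p a = (m : ℝ) / (M : ℝ)}).Finite :=
    (Set.Finite.pi fun _ : α => hfin).subset fun p hp a _ => hp.2 a
  exact h.to_subtype

instance DiscreteSimplex.instFintype (α : Type*) [Fintype α] (M : ℕ) :
    Fintype (DiscreteSimplex α M) :=
  Fintype.ofFinite _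

variable {I : Type*} [Fintype I] [DecidableEq I] {A : I → Type*} [∀ i, Fintype (A i)]

variable (A) in
/-- The beliefs of player `i`: one discretized mixed strategy for each opponent. -/
abbrev Belief (M : ℕ) (i : I) : Type _ := ∀ j : {j // j ≠ i}, DiscreteSimplex (A j) M

/-- The probability vectors that make up a belief. -/
def Belief.vec {M : ℕ} {i : I} (b : Belief A M i) : ∀ j : {j // j ≠ i}, A j → ℝ :=
  fun j => (b j).1

/-- `U_i(π)`, the expected payoff of player `i` under the mixed profile `π`. -/
def expectedUtility (u : I → (∀ j, A j) → ℝ) (i : I) (π : ∀ j, A j → ℝ) : ℝ :=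
  ∑ a : (∀ j, A j), (∏ j, π j (a j)) * u i a

/-- `U_i(a_i, b_i)`, the expected payoff of the action `x` of player `i` against independent
opponents with mixed strategies `y`. -/
def actionUtility (u : I → (∀ j, A j) → ℝ) (i : I) (x : A i)
    (y : ∀ j : {j // j ≠ i}, A j → ℝ) : ℝ :=
  ∑ c : (∀ j : {j // j ≠ i}, A j), u i (joinAt i x c) * ∏ j, y j (c j)

/-- The smooth (logit) best response of player `i` with temperature `σ`. -/
def smoothBR (u : I → (∀ j, A j) → ℝ) (σ : ℝ) (i : I) (y : ∀ j : {j // j ≠ i}, A j → ℝ) :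
    A i → ℝ :=
  fun x => Real.exp (1 / σ * actionUtility u i x y) /
    ∑ x' : A i, Real.exp (1 / σ * actionUtility u i x' y)

/-- The states: belief profiles together with the associated smooth best responses. -/
@[ext]
structure State (u : I → (∀ j, A j) → ℝ) (σ : ℝ) (M : ℕ) where
  belief : ∀ i, Belief A M i
  strategy : ∀ i, A i → ℝ
  strategy_eq : ∀ i, strategy i = smoothBR u σ i (belief i).vec

instance State.instFinite (u : I → (∀ j, A j) → ℝ) (σ : ℝ) (M : ℕ) : Finite (State u σ M) := by
  refine Finite.of_injective (fun z : State u σ M => z.belief) fun z w h => ?_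
  have hb : z.belief = w.belief := h
  refine State.ext hb (funext fun i => ?_)
  rw [z.strategy_eq, w.strategy_eq, hb]

instance State.instFintype (u : I → (∀ j, A j) → ℝ) (σ : ℝ) (M : ℕ) : Fintype (State u σ M) :=
  Fintype.ofFinite _

/-- The strategies of the opponents of `i` in a state. -/
def State.others {u : I → (∀ j, A j) → ℝ} {σ : ℝ} {M : ℕ} (z : State u σ M) (i : I) :
    ∀ j : {j // j ≠ i}, A j → ℝ :=
  fun j => z.strategy j

/-- `U_i(π_i, b_i)`, the utility that player `i` anticipates in a state. -/
def State.utility {u : I → (∀ j, A j) → ℝ} {σ : ℝ} {M : ℕ} (z : State u σ M) (i : I) : ℝ :=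
  expectedUtility u i (joinAt i (z.strategy i) (z.belief i).vec)

/-- `min_i U_i(π_i, b_i)`. -/
def State.minUtility {u : I → (∀ j, A j) → ℝ} {σ : ℝ} {M : ℕ} (z : State u σ M) : ℝ :=
  ⨅ i, z.utility i

/-- The consistent states. -/
def consistentStates (u : I → (∀ j, A j) → ℝ) (σ τ : ℝ) (M : ℕ) : Set (State u σ M) :=
  {z | ∀ i, profileDist (z.belief i).vec (z.others i) ≤ τ}

/-- The least utility of player `i` over all states. -/
def minUtilityOf (u : I → (∀ j, A j) → ℝ) (σ : ℝ) (M : ℕ) (i : I) : ℝ :=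
  ⨅ z : State u σ M, z.utility i

/-- The greatest utility of player `i` over all states. -/
def maxUtilityOf (u : I → (∀ j, A j) → ℝ) (σ : ℝ) (M : ℕ) (i : I) : ℝ :=
  ⨆ z : State u σ M, z.utility i

/-! ### The two assumptions on the parameters -/

/-- The largest absolute payoff. -/
def maxPayoff (u : I → (∀ j, A j) → ℝ) : ℝ := ⨆ i, ⨆ a, |u i a|

variable (A) in
/-- The largest number of actions of a player. -/
def maxActions : ℕ := Finset.univ.sup fun i => Fintype.card (A i)

variable (A) in
/-- `|A_{-i}|`, the number of joint actions of the opponents of `i`. -/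
def oppActions (i : I) : ℕ := Fintype.card (∀ j : {j // j ≠ i}, A j)

variable (A) in
/-- `max_i |A_i| |A_{-i}|`. -/
def maxProfiles : ℕ := Finset.univ.sup fun i => Fintype.card (A i) * oppActions A i

/-- `σ` and `τ` are small and `M` is large. (The bounds on `σ` and `τ` are written without
division, so that a zero denominator stands for no restriction.) -/
structure SmallParameters (u : I → (∀ j, A j) → ℝ) (ε σ τ : ℝ) (M : ℕ) : Prop where
  sigma_le : σ * (2 * Real.log (maxActions A)) ≤ ε
  tau_le : τ * (2 * √(Fintype.card (∀ j, A j) : ℝ) * (maxPayoff u * maxProfiles A)) ≤ ε * σ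
  le_M : (Fintype.card I : ℝ) * maxActions A / τ *
      (1 + √(maxActions A : ℝ) / σ * maxPayoff u * maxProfiles A * Fintype.card I) ≤ (M : ℝ)

/-- Whatever the beliefs `b j` of the opponents `j` of `i` and their smooth best responses are,
player `i` has a belief that is inconsistent with those strategies and whose smooth best response
is inconsistent with the belief of each opponent about `i`. -/
def HasDestabilizingBeliefs (u : I → (∀ j, A j) → ℝ) (σ τ : ℝ) (M : ℕ) : Prop :=
  ∀ (i : I) (b : ∀ j : {j // j ≠ i}, Belief A M (j : I)), ∃ c : Belief A M i,
    τ < profileDist c.vec (fun j : {j // j ≠ i} => smoothBR u σ (j : I) (b j).vec) ∧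
    ∀ j : {j // j ≠ i}, τ < l2Dist (smoothBR u σ i c.vec) ((b j).vec ⟨i, j.2.symm⟩)

/-! ### The learning dynamics -/

/-- The choices that the learning dynamics leaves open: test probabilities `γ`, utility
transformations `f`, the exponent `ubar` of the significance level, the sample size `T α` used at
significance level `α`, and the resampling kernels, where `ψ i b b'` is the probability that
player `i` with belief `b` resamples the belief `b'`. -/
structure LearningRule (u : I → (∀ j, A j) → ℝ) (σ τ : ℝ) (M : ℕ) where
  γ : I → ℝ
  γ_pos : ∀ i, 0 < γ i
  γ_le_one : ∀ i, γ i ≤ 1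
  f : I → ℝ → ℝ
  f_pos : ∀ i x, 0 < f i x
  f_strictMono : ∀ i, StrictMono (f i)
  ubar : ℝ
  sum_lt_ubar : ∀ π : (∀ i, A i → ℝ), (∀ i, π i ∈ stdSimplex ℝ (A i)) →
    ∑ i, f i (expectedUtility u i π) < ubar
  T : ℝ → ℕ
  T_pos : ∀ α ∈ Set.Ioo (0 : ℝ) 1, 0 < T α
  le_T : ∀ α ∈ Set.Ioo (0 : ℝ) 1, ∀ (i : I) (c : Belief A M i) (z : State u σ M),
    τ < profileDist (z.others i) c.vec →
      2 * (oppActions A i : ℝ) / (profileDist (z.others i) c.vec - τ) ^ 2 * Real.log (2 / α)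
        ≤ (T α : ℝ)
  ψ : ∀ i, Belief A M i → Belief A M i → ℝ
  lam : ℝ
  lam_pos : 0 < lam
  lam_le : ∀ i b b', lam ≤ ψ i b b'
  sum_ψ : ∀ i b, ∑ b', ψ i b b' = 1

open Classical in
/-- The empirical strategies of the opponents of `i` in `T` observed rounds: the frequency of each
action of each opponent (the marginals of the empirical distribution on the joint actions). -/
def empirical {T : ℕ} (ω : Fin T → ∀ j, A j) (i : I) : ∀ j : {j // j ≠ i}, A j → ℝ :=
  fun j x => 1 / (T : ℝ) * ∑ t : Fin T, if ω t j = x then 1 else 0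

/-- The observations `ω` make player `i` with belief `c` reject at significance level `α`. -/
def Rejects (τ α : ℝ) {T : ℕ} (ω : Fin T → ∀ j, A j) {M : ℕ} (i : I) (c : Belief A M i) : Prop :=
  τ + √((oppActions A i : ℝ) / (2 * (T : ℝ)) * Real.log (2 / α)) < profileDist (empirical ω i) c.vec

/-- The probability of observing `ω` when actions are drawn independently across rounds and
players, player `j` using the mixed strategy `π j`. -/
def sampleProb {T : ℕ} (π : ∀ j, A j → ℝ) (ω : Fin T → ∀ j, A j) : ℝ :=
  ∏ t, ∏ j, π j (ω t j)

namespace LearningRule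

variable {u : I → (∀ j, A j) → ℝ} {σ τ : ℝ} {M : ℕ} (L : LearningRule u σ τ M)

/-- The significance level at exploration parameter `ξ`. -/
def level (ξ : ℝ) : ℝ := ξ ^ L.ubar

open Classical in
/-- The probability that player `i`, who has decided to test, resamples in state `z` after the
observations `ω`: surely if the test rejects, and with the exploration probability otherwise. -/
def resampleProb (ξ : ℝ) (z : State u σ M) {T : ℕ} (ω : Fin T → ∀ j, A j) (i : I) : ℝ :=
  if Rejects τ (L.level ξ) ω i (z.belief i) then 1 else ξ ^ L.f i (z.utility i)

open Classical in
/-- The probability that player `i` holds the belief `c` after the epoch, given the state `z`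
during the epoch and the observations `ω`. -/
def updateProb (ξ : ℝ) (z : State u σ M) {T : ℕ} (ω : Fin T → ∀ j, A j) (i : I)
    (c : Belief A M i) : ℝ :=
  L.γ i * (L.resampleProb ξ z ω i * L.ψ i (z.belief i) c +
      (1 - L.resampleProb ξ z ω i) * (if c = z.belief i then 1 else 0)) +
    (1 - L.γ i) * (if c = z.belief i then 1 else 0)

/-- The transition matrix `P^ξ`: all players observe the same play of the epoch, and then update
independently of each other. -/
def transition (ξ : ℝ) : Matrix (State u σ M) (State u σ M) ℝ :=
  fun z z' => ∑ ω : (Fin (L.T (L.level ξ)) → ∀ j, A j),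
    sampleProb z.strategy ω * ∏ i, L.updateProb ξ z ω i (z'.belief i)

end LearningRule

/-- `μ` is a stationary distribution of the Markov chain with transition matrix `P`. -/
def IsStationary {S : Type*} [Fintype S] (P : Matrix S S ℝ) (μ : S → ℝ) : Prop :=
  μ ∈ stdSimplex ℝ S ∧ Matrix.vecMul μ P = μ

namespace LearningRule

variable {u : I → (∀ j, A j) → ℝ} {σ τ : ℝ} {M : ℕ} (L : LearningRule u σ τ M)

open Classical in
/-- The stationary distribution `μ^ξ` of `P^ξ` (zero if there is none). -/
def stationary (ξ : ℝ) : State u σ M → ℝ :=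
  if h : ∃ μ, IsStationary (L.transition ξ) μ then h.choose else 0

/-- The stochastically stable states: those `z` for which the limit of `μ^ξ z` as `ξ` decreases to
zero is positive. -/
def stableStates : Set (State u σ M) :=
  {z | ∃ l : ℝ, 0 < l ∧ Tendsto (fun ξ => L.stationary ξ z) (𝓝[>] 0) (𝓝 l)}

end LearningRule

end HypothesisTesting

end

open HypothesisTesting

/-! As ξ tends to 0, a correct test makes a testing player resample surely if the belief is
inconsistent, and with probability ξ^{f_i(U_i)} if it is consistent. So transitions out of a state z
have order at most ξ^{c(z)}, where c(z), the `cost`, is the least of these exponents over the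
players, an inconsistent player having exponent 0. By Hoeffding's inequality and a union bound,
wrong tests have probability O(ξ^H) with H > c(z), which is negligible
(`tendsto_transition_sub_idealTransition_div`).

(A2) makes an analysis of spanning trees unnecessary. From any z the cheapest player alone can move,
at order ξ^{c(z)}, to a state in which everybody is inconsistent, and from there every state is
reached with probability bounded below. Hence, if row z of P^ξ - 1 is divided by ξ^{c(z)}, the
matrix converges to an irreducible generator. Its normalized null vector w is unique and positive,
and null vectors converge to it by compactness. Undoing the scaling, μ^ξ_z is proportional to about
w_z ξ^{-c(z)}, so the limit exists and charges exactly the maximizers of c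
(`exists_tendsto_isStationary`).

The cost is positive exactly on the consistent states. These exist: Brouwer's theorem gives a logit
equilibrium, and its rounding to the grid, used as the common belief, is consistent for large M
(`consistentStates_nonempty`). On consistent states the cost is a strictly increasing function of
min_i U_i in case (i) and of the utility of the distinguished player in case (ii). -/

/-! ### Generators of Markov chains -/

namespace HypothesisTesting

section Generator

variable {S : Type*} [Fintype S]

/-- A rate matrix: the entries off the diagonal are nonnegative and the rows sum to zero. -/
structure IsGenerator (G : Matrix S S ℝ) : Prop where
  nonneg : ∀ z z', z ≠ z' → 0 ≤ G z z'
  sum_eq_zero : ∀ z, ∑ z', G z z' = 0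

/-- From every state there is a jump to a state (or the state itself is one) from which
all other states can be reached in one jump. -/
def HasHubs (G : Matrix S S ℝ) : Prop :=
  ∀ z, ∃ d, (z = d ∨ 0 < G z d) ∧ ∀ z', z' ≠ d → 0 < G d z'

/-- Nonnegative rates off the diagonal make every coordinate of |v|G nonnegative, while the zero row
sums make the coordinates add up to 0. -/
theorem IsGenerator.abs_vecMul_eq_zero {G : Matrix S S ℝ} (hG : IsGenerator G) {v : S → ℝ}
    (hv : Matrix.vecMul v G = 0) : Matrix.vecMul |v| G = 0 := by
  have hnn : ∀ z', 0 ≤ Matrix.vecMul |v| G z' := by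
    intro z'
    -- With s the sign of `v z'`, the diagonal term is unchanged, so the sign of the diagonal entry
    -- does not matter.
    have key : ∀ s : ℝ, |s| = 1 → s * v z' = |v z'| →
        s * Matrix.vecMul v G z' ≤ Matrix.vecMul |v| G z' := by
      intro s hs hsv
      simp only [Matrix.vecMul, dotProduct, Finset.mul_sum]
      refine Finset.sum_le_sum fun z _ => ?_
      rw [← mul_assoc]
      by_cases h : z = z'
      · subst h; simp [hsv]
      · refine mul_le_mul_of_nonneg_right ?_ (hG.nonneg z z' h)
        calc s * v z ≤ |s * v z| := le_abs_self _
          _ = |v| z := by rw [abs_mul, hs, one_mul, Pi.abs_apply]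
    rcases abs_choice (v z') with h | h
    · have := key 1 (by simp) (by simp [h])
      simpa [hv] using this
    · have := key (-1) (by simp) (by simp [h])
      simpa [hv] using this
  have hsum : ∑ z', Matrix.vecMul |v| G z' = 0 := by
    simp only [Matrix.vecMul, dotProduct]
    rw [Finset.sum_comm]
    simp [← Finset.mul_sum, hG.sum_eq_zero]
  funext z'
  exact (Finset.sum_eq_zero_iff_of_nonneg fun z _ => hnn z).1 hsum z' (Finset.mem_univ _)

/-- At a zero of v the null equation is a vanishing sum of nonnegative terms, so zeros spread
backwards along positive rates: from `z₀` to the hub of z, and from the hub to z. -/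
theorem IsGenerator.eq_zero_of_apply_eq_zero {G : Matrix S S ℝ} (hG : IsGenerator G)
    (hub : HasHubs G) {v : S → ℝ} (hv : Matrix.vecMul v G = 0) (hnn : ∀ z, 0 ≤ v z)
    {z₀ : S} (h₀ : v z₀ = 0) : v = 0 := by
  have key : ∀ z₀, v z₀ = 0 → ∀ z, 0 < G z z₀ → v z = 0 := by
    intro z₀ h₀ z hz
    have h := congrFun hv z₀
    simp only [Matrix.vecMul, dotProduct, Pi.zero_apply] at h
    have h2 := (Finset.sum_eq_zero_iff_of_nonneg (fun y _ => ?_)).1 h z (Finset.mem_univ _)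
    · exact (mul_eq_zero.1 h2).resolve_right hz.ne'
    · by_cases hy : y = z₀
      · simp [hy, h₀]
      · exact mul_nonneg (hnn y) (hG.nonneg _ _ hy)
  funext z
  obtain ⟨d, hd, hd'⟩ := hub z
  have hvd : v d = 0 := by
    by_cases h : z₀ = d
    · rwa [← h]
    · exact key z₀ h₀ d (hd' z₀ h)
  rcases hd with rfl | hd
  · exact hvd
  · exact key d hvd z hd

theorem IsGenerator.pos_of_mem_stdSimplex {G : Matrix S S ℝ} (hG : IsGenerator G)
    (hub : HasHubs G) {v : S → ℝ} (hv : Matrix.vecMul v G = 0) (hs : v ∈ stdSimplex ℝ S) (z : S) :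
    0 < v z := by
  refine (hs.1 z).lt_of_ne fun h => ?_
  have := hG.eq_zero_of_apply_eq_zero hub hv hs.1 h.symm
  have h1 := hs.2
  simp [this] at h1

/-- The difference x has sum 0, and |x| + x, twice its positive part, is a nonnegative null vector.
If x is positive somewhere, this vector vanishes nowhere, so x > 0 everywhere, against the sum being
0. -/
theorem IsGenerator.eq_of_mem_stdSimplex {G : Matrix S S ℝ} (hG : IsGenerator G)
    (hub : HasHubs G) {v w : S → ℝ} (hv : Matrix.vecMul v G = 0) (hvs : v ∈ stdSimplex ℝ S)
    (hw : Matrix.vecMul w G = 0) (hws : w ∈ stdSimplex ℝ S) : v = w := by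
  set x := v - w with hx
  have hx0 : Matrix.vecMul x G = 0 := by rw [hx, Matrix.sub_vecMul, hv, hw, sub_zero]
  have hxsum : ∑ z, x z = 0 := by
    simp only [hx, Pi.sub_apply, Finset.sum_sub_distrib, hvs.2, hws.2, sub_self]
  have hp0 : Matrix.vecMul (|x| + x) G = 0 := by
    rw [Matrix.add_vecMul, hG.abs_vecMul_eq_zero hx0, hx0, add_zero]
  have hpn : ∀ z, 0 ≤ (|x| + x) z := fun z => by
    simp only [Pi.add_apply, Pi.abs_apply]
    linarith [neg_abs_le (x z)]
  have hle : ∀ z, x z ≤ 0 := by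
    by_contra! hcon
    obtain ⟨z₁, hz₁⟩ := hcon
    have hall : ∀ z, 0 < x z := by
      intro z
      by_contra! hz
      have : (|x| + x) z = 0 := by simp [abs_of_nonpos hz]
      have := congrFun (hG.eq_zero_of_apply_eq_zero hub hp0 hpn this) z₁
      simp only [Pi.add_apply, Pi.abs_apply, Pi.zero_apply] at this
      linarith [abs_nonneg (x z₁)]
    have := Finset.sum_pos (fun z _ => hall z) ⟨z₁, Finset.mem_univ _⟩
    linarith
  have hz := (Finset.sum_eq_zero_iff_of_nonpos fun z _ => hle z).1 hxsum
  funext z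
  have := hz z (Finset.mem_univ _)
  simp only [hx, Pi.sub_apply] at this
  linarith

/-- The null vectors of convergent matrices converge if the limit is an irreducible generator. -/
theorem IsGenerator.exists_tendsto {X : Type*} {l : Filter X} [l.NeBot]
    {G : X → Matrix S S ℝ} {G₀ : Matrix S S ℝ} (hG : IsGenerator G₀) (hub : HasHubs G₀)
    (hlim : ∀ z z', Tendsto (fun x => G x z z') l (𝓝 (G₀ z z')))
    {w : X → S → ℝ} (hw : ∀ᶠ x in l, w x ∈ stdSimplex ℝ S ∧ Matrix.vecMul (w x) (G x) = 0) :
    ∃ w₀ : S → ℝ, (∀ z, 0 < w₀ z) ∧ Tendsto w l (𝓝 w₀) := by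
  -- Every cluster point is a null vector of the limit matrix, hence unique. In the compact simplex
  -- a unique cluster point is a limit.
  have hcl : ∀ y ∈ stdSimplex ℝ S, MapClusterPt y l w → Matrix.vecMul y G₀ = 0 := by
    intro y _ hy
    obtain ⟨U, hU, hUy⟩ := mapClusterPt_iff_ultrafilter.1 hy
    funext z'
    have h1 : Tendsto (fun x => Matrix.vecMul (w x) (G x) z') U (𝓝 (Matrix.vecMul y G₀ z')) := by
      simp only [Matrix.vecMul, dotProduct]
      refine tendsto_finsetSum _ fun z _ => ?_
      exact ((tendsto_pi_nhds.1 hUy) z).mul ((hlim z z').mono_left hU)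
    have h2 : Tendsto (fun x => Matrix.vecMul (w x) (G x) z') U (𝓝 0) := by
      refine tendsto_const_nhds.congr' ?_
      filter_upwards [hU hw] with x hx
      rw [hx.2]; rfl
    exact tendsto_nhds_unique h1 h2
  obtain ⟨w₀, hw₀, hc⟩ := (isCompact_stdSimplex ℝ S).exists_mapClusterPt_of_frequently
    (hw.mono fun x hx => hx.1).frequently
  refine ⟨w₀, hG.pos_of_mem_stdSimplex hub (hcl _ hw₀ hc) hw₀, ?_⟩
  exact (isCompact_stdSimplex ℝ S).tendsto_nhds_of_unique_mapClusterPt (hw.mono fun x hx => hx.1)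
    fun y hy hy' => hG.eq_of_mem_stdSimplex hub (hcl _ hy hy') hy (hcl _ hw₀ hc) hw₀

open Classical in
/-- A positive stochastic matrix has exactly one stationary distribution. -/
theorem existsUnique_isStationary [Nonempty S] {P : Matrix S S ℝ} (hpos : ∀ z z', 0 < P z z')
    (hsum : ∀ z, ∑ z', P z z' = 1) : ∃! μ, IsStationary P μ := by
  have hG : IsGenerator (P - 1) :=
    ⟨fun z z' h => by simp [h, (hpos z z').le],
      fun z => by simp [Matrix.one_apply, hsum]⟩
  have hub : HasHubs (P - 1) := fun z => ⟨z, Or.inl rfl, fun z' h => by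
    simp [h.symm, hpos]⟩
  have hiff : ∀ μ : S → ℝ, Matrix.vecMul μ P = μ ↔ Matrix.vecMul μ (P - 1) = 0 := fun μ => by
    rw [Matrix.vecMul_sub, Matrix.vecMul_one, sub_eq_zero]
  -- The constant vector is a right null vector, so a left one exists as well; its normalized
  -- absolute value is stationary.
  have hdet : (P - 1).det = 0 := by
    refine Matrix.exists_mulVec_eq_zero_iff.1 ⟨1, one_ne_zero, ?_⟩
    funext z
    simpa [Matrix.mulVec, dotProduct] using hG.sum_eq_zero z
  obtain ⟨v, hv, hv0⟩ := Matrix.exists_vecMul_eq_zero_iff.2 hdet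
  have hs : 0 < ∑ z, |v| z := by
    obtain ⟨z, hz⟩ := Function.ne_iff.1 hv
    exact Finset.sum_pos' (fun z _ => abs_nonneg _) ⟨z, Finset.mem_univ _, abs_pos.2 hz⟩
  refine ⟨(∑ z, |v| z)⁻¹ • |v|, ⟨⟨fun z => ?_, ?_⟩, ?_⟩, ?_⟩
  · exact mul_nonneg (inv_nonneg.2 hs.le) (abs_nonneg _)
  · simp only [Pi.smul_apply, smul_eq_mul, ← Finset.mul_sum]
    exact inv_mul_cancel₀ hs.ne'
  · rw [hiff, Matrix.smul_vecMul, hG.abs_vecMul_eq_zero hv0, smul_zero]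
  · rintro μ ⟨hμ, hμ'⟩
    refine hG.eq_of_mem_stdSimplex hub ((hiff _).1 hμ') hμ ?_ ⟨fun z => ?_, ?_⟩
    · rw [Matrix.smul_vecMul, hG.abs_vecMul_eq_zero hv0, smul_zero]
    · exact mul_nonneg (inv_nonneg.2 hs.le) (abs_nonneg _)
    · simp only [Pi.smul_apply, smul_eq_mul, ← Finset.mul_sum]
      exact inv_mul_cancel₀ hs.ne'

open Classical in
/-- Stationary distributions of a family of chains in which the state `z` is left at rate
`ξ ^ c z`: if the rescaled rates converge to an irreducible generator, the stationary
distributions converge, and the limit is concentrated on the states that maximize `c`. -/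
theorem exists_tendsto_isStationary [Nonempty S] {P : ℝ → Matrix S S ℝ} {c : S → ℝ}
    {G : Matrix S S ℝ} (hG : IsGenerator G) (hub : HasHubs G)
    (hlim : ∀ z z', Tendsto (fun ξ : ℝ => (P ξ z z' - if z = z' then 1 else 0) / ξ ^ c z)
      (𝓝[>] 0) (𝓝 (G z z')))
    {μ : ℝ → S → ℝ} (hμ : ∀ᶠ ξ in 𝓝[>] 0, IsStationary (P ξ) (μ ξ)) :
    ∃ μ₀ : S → ℝ, (∀ z, Tendsto (fun ξ => μ ξ z) (𝓝[>] 0) (𝓝 (μ₀ z))) ∧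
      ∀ z, 0 < μ₀ z ↔ ∀ z', c z' ≤ c z := by
  -- Weighting `μ ξ z` by ξ^{c z} compensates the division of row z, so w is a null vector of the
  -- rescaled matrix.
  set N : ℝ → ℝ := fun ξ => ∑ z, μ ξ z * ξ ^ c z
  set w : ℝ → S → ℝ := fun ξ z => μ ξ z * ξ ^ c z / N ξ with hw
  have hpos : ∀ᶠ ξ : ℝ in 𝓝[>] 0, 0 < ξ := eventually_mem_nhdsWithin
  have hN : ∀ ξ, 0 < ξ → IsStationary (P ξ) (μ ξ) → 0 < N ξ := by
    intro ξ hξ hst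
    have : ∃ z, 0 < μ ξ z := by
      by_contra! hcon
      have := hst.1.2
      linarith [Finset.sum_nonpos fun z (_ : z ∈ Finset.univ) => hcon z]
    obtain ⟨z, hz⟩ := this
    exact Finset.sum_pos' (fun z _ => mul_nonneg (hst.1.1 z) (Real.rpow_pos_of_pos hξ _).le)
      ⟨z, Finset.mem_univ _, mul_pos hz (Real.rpow_pos_of_pos hξ _)⟩
  obtain ⟨w₀, hw₀, hwlim⟩ := hG.exists_tendsto hub
    (G := fun ξ z z' => (P ξ z z' - if z = z' then 1 else 0) / ξ ^ c z) hlim (w := w) (by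
      filter_upwards [hμ, hpos] with ξ hst hξ
      have hNξ := hN ξ hξ hst
      refine ⟨⟨fun z => div_nonneg (mul_nonneg (hst.1.1 z) (Real.rpow_pos_of_pos hξ _).le) hNξ.le,
        ?_⟩, ?_⟩
      · simp only [hw, ← Finset.sum_div]
        exact div_self hNξ.ne'
      · funext z'
        have h1 := congrFun hst.2 z'
        simp only [Matrix.vecMul, dotProduct] at h1
        have h2 : ∀ z, w ξ z * ((P ξ z z' - if z = z' then 1 else 0) / ξ ^ c z)
            = (μ ξ z * P ξ z z' - if z = z' then μ ξ z else 0) / N ξ := by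
          intro z
          have := (Real.rpow_pos_of_pos hξ (c z)).ne'
          simp only [hw]
          split_ifs
          · field_simp
          · field_simp
            ring
        simp only [Matrix.vecMul, dotProduct, h2, ← Finset.sum_div, Finset.sum_sub_distrib, h1]
        simp)
  obtain ⟨zm, hzm⟩ := Finite.exists_max c
  set D : ℝ := ∑ z, w₀ z * if c z = c zm then 1 else 0 with hD
  have hDpos : 0 < D := by
    refine Finset.sum_pos' (fun z _ => ?_) ⟨zm, Finset.mem_univ _, ?_⟩
    · split_ifs <;> simp [(hw₀ z).le]
    · simp [hw₀ zm]
  -- `μ ξ z` is proportional to `w ξ z * ξ ^ (-c z)`. The common factor ξ^{max c} keeps the limit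
  -- finite and kills all states that do not maximize c.
  have hterm : ∀ z, Tendsto (fun ξ : ℝ => w ξ z * ξ ^ (c zm - c z)) (𝓝[>] 0)
      (𝓝 (w₀ z * if c z = c zm then 1 else 0)) := by
    intro z
    refine (tendsto_pi_nhds.1 hwlim z).mul ?_
    split_ifs with h
    · simp [h]
    · have : 0 < c zm - c z := sub_pos.2 ((hzm z).lt_of_ne h)
      have h0 := (Real.continuousAt_rpow_const 0 _ (Or.inr this.le)).tendsto
      rw [Real.zero_rpow this.ne'] at h0
      exact h0.mono_left nhdsWithin_le_nhds
  refine ⟨fun z => (w₀ z * if c z = c zm then 1 else 0) / D, fun z => ?_, fun z => ?_⟩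
  · refine ((hterm z).div (tendsto_finsetSum Finset.univ fun z _ => hterm z) hDpos.ne').congr' ?_
    filter_upwards [hμ, hpos] with ξ hst hξ
    have hNξ := (hN ξ hξ hst).ne'
    have h1 : ∀ y, w ξ y * ξ ^ (c zm - c y) = μ ξ y * (ξ ^ c zm / N ξ) := by
      intro y
      have := (Real.rpow_pos_of_pos hξ (c y)).ne'
      rw [Real.rpow_sub hξ]
      simp only [hw]
      field_simp
    have h2 : ξ ^ c zm / N ξ ≠ 0 := div_ne_zero (Real.rpow_pos_of_pos hξ _).ne' hNξ
    simp only [Pi.div_apply, h1, ← Finset.sum_mul, hst.1.2, one_mul]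
    exact mul_div_cancel_right₀ _ h2
  · beta_reduce
    constructor
    · intro h z'
      split_ifs at h with hc
      · exact hc ▸ hzm z'
      · simp at h
    · intro h
      have hc : c z = c zm := le_antisymm (hzm z) (h zm)
      rw [if_pos hc, mul_one]
      exact div_pos (hw₀ z) hDpos

end Generator

end HypothesisTesting

/-! ### Brouwer's fixed point theorem for continuously differentiable maps -/

namespace HypothesisTesting

section Brouwer

open MeasureTheory Metric

variable {E : Type*} [NormedAddCommGroup E] [InnerProductSpace ℝ E]

/-- A map that is Lipschitz on a ball and zero on the complement of its interior is Lipschitz. -/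
theorem lipschitzWith_of_closedBall {g : E → E} {K : NNReal} {R : ℝ}
    (hg : LipschitzOnWith K g (closedBall 0 R)) (h0 : ∀ x, R ≤ ‖x‖ → g x = 0) :
    LipschitzWith K g := by
  have key : ∀ x y, ‖x‖ ≤ R → R ≤ ‖y‖ → dist (g x) (g y) ≤ K * dist x y := by
    intro x y hx hy
    -- The segment from x to y meets the sphere of radius R, where g already vanishes.
    obtain ⟨t, ht, hts⟩ : ∃ t ∈ Set.Icc (0 : ℝ) 1, ‖AffineMap.lineMap x y t‖ = R := by
      have hcont : ContinuousOn (fun t : ℝ => ‖(AffineMap.lineMap x y t : E)‖) (Set.Icc 0 1) :=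
        (AffineMap.lineMap_continuous.norm).continuousOn
      exact intermediate_value_Icc zero_le_one hcont ⟨by simpa using hx, by simpa using hy⟩
    set s : E := AffineMap.lineMap x y t
    have h1 := hg.dist_le_mul x (by simpa using hx) s (by simp [hts])
    rw [h0 y hy, ← h0 s hts.ge]
    refine h1.trans (mul_le_mul_of_nonneg_left ?_ K.2)
    rw [dist_left_lineMap, Real.norm_of_nonneg ht.1]
    exact mul_le_of_le_one_left dist_nonneg ht.2
  refine LipschitzWith.of_dist_le_mul fun x y => ?_
  rcases le_total ‖x‖ R with hx | hx <;> rcases le_total ‖y‖ R with hy | hy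
  · exact hg.dist_le_mul x (by simpa using hx) y (by simpa using hy)
  · exact key x y hx hy
  · rw [dist_comm, dist_comm x]; exact key y x hy hx
  · rw [h0 x hx, h0 y hy, dist_self]; positivity

variable [FiniteDimensional ℝ E]

theorem exists_polynomial_eval_eq_det_matrix {n : Type*} [Fintype n] [DecidableEq n]
    (m : Matrix n n ℝ) :
    ∃ p : Polynomial ℝ, p.natDegree ≤ Fintype.card n ∧ ∀ t : ℝ, p.eval t = (1 + t • m).det := by
  refine ⟨((Polynomial.X : Polynomial ℝ) • m.map Polynomial.C +
    (1 : Matrix _ _ ℝ).map Polynomial.C).det, Polynomial.natDegree_det_X_add_C_le m 1,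
    fun t => ?_⟩
  rw [← Polynomial.coe_evalRingHom, RingHom.map_det]
  congr 1
  ext i j
  by_cases h : i = j
  · simp [h, add_comm]
    ring
  · simp [h]
    ring

/-- The Jacobian of x + t(h x - x) is polynomial in t with a degree bound independent of x. So its
value at t = 1 is a combination, with the same coefficients for all x, of its values at small t. -/
theorem exists_polynomial_eval_eq_det (A : E →L[ℝ] E) :
    ∃ p : Polynomial ℝ, p.natDegree ≤ Module.finrank ℝ E ∧
      ∀ t : ℝ, p.eval t = (ContinuousLinearMap.id ℝ E + t • A).det := by
  set b := Module.finBasis ℝ E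
  obtain ⟨p, hp, hpe⟩ :=
    exists_polynomial_eval_eq_det_matrix (LinearMap.toMatrix b b (A : E →ₗ[ℝ] E))
  refine ⟨p, by simpa using hp, fun t => ?_⟩
  rw [hpe, ContinuousLinearMap.det, ← LinearMap.det_toMatrix b, ContinuousLinearMap.toLinearMap_add,
    ContinuousLinearMap.toLinearMap_smul, map_add, map_smul, ContinuousLinearMap.coe_id,
    LinearMap.toMatrix_id]

/-- A real polynomial of degree at most `n` is at `1` a fixed affine combination of its values at
`n + 1` given nodes. -/
theorem exists_eval_one_eq_sum (n : ℕ) {δ : ℝ} (hδ : 0 < δ) :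
    ∃ v c : Fin (n + 1) → ℝ, (∀ i, v i ∈ Set.Ioo 0 δ) ∧ ∑ i, c i = 1 ∧
      ∀ p : Polynomial ℝ, p.natDegree ≤ n → p.eval 1 = ∑ i, c i * p.eval (v i) := by
  set v : Fin (n + 1) → ℝ := fun i => δ * (i + 1) / (n + 2) with hv
  have hn : (0 : ℝ) < n + 2 := by positivity
  have hinj : Set.InjOn v (Finset.univ : Finset (Fin (n + 1))) := by
    intro i _ j _ hij
    simp only [hv] at hij
    rw [div_left_inj' hn.ne', mul_right_inj' hδ.ne', add_left_inj] at hij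
    exact Fin.ext (by exact_mod_cast hij)
  refine ⟨v, fun i => (Lagrange.basis Finset.univ v i).eval 1, fun i => ⟨by positivity, ?_⟩, ?_, ?_⟩
  · have : (i : ℝ) + 1 ≤ n + 1 := by
      have := i.is_le
      exact_mod_cast Nat.succ_le_succ this
    simp only [hv]
    rw [div_lt_iff₀ hn]
    nlinarith
  · rw [← Polynomial.eval_finsetSum, Lagrange.sum_basis hinj Finset.univ_nonempty,
      Polynomial.eval_one]
  · intro p hp
    have hdeg : p.degree < (Finset.univ : Finset (Fin (n + 1))).card := by
      rw [Finset.card_univ, Fintype.card_fin]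
      exact (Polynomial.degree_le_of_natDegree_le hp).trans_lt (by exact_mod_cast Nat.lt_succ_self n)
    conv_lhs => rw [Lagrange.eq_interpolate hinj hdeg]
    rw [Lagrange.interpolate_apply, Polynomial.eval_finsetSum]
    refine Finset.sum_congr rfl fun i _ => ?_
    rw [Polynomial.eval_mul, Polynomial.eval_C, mul_comm]

theorem bijective_add_of_lipschitzWith {g : E → E} {K : NNReal} (hK : K < 1)
    (hg : LipschitzWith K g) : Function.Bijective fun x => x + g x := by
  constructor
  · intro x y hxy
    by_contra hne
    have h1 : x - y = g y - g x := by
      have : x + g x = y + g y := hxy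
      rw [sub_eq_sub_iff_add_eq_add, this, add_comm]
    have h2 := hg.dist_le_mul y x
    rw [dist_eq_norm, ← h1, dist_comm, dist_eq_norm] at h2
    have h3 : 0 < ‖x - y‖ := norm_pos_iff.2 (sub_ne_zero.2 hne)
    have h4 : (K : ℝ) < 1 := by exact_mod_cast hK
    nlinarith
  · intro y
    have hc : ContractingWith K fun x => y - g x := by
      refine ⟨hK, LipschitzWith.of_dist_le_mul fun a b => ?_⟩
      rw [dist_sub_left]
      exact hg.dist_le_mul a b
    refine ⟨hc.fixedPoint, ?_⟩
    have := hc.fixedPoint_isFixedPt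
    rw [Function.IsFixedPt] at this
    exact (sub_eq_iff_eq_add.1 this).symm

/-- Differentiating the constant ⟨h, h⟩ shows that the range of the derivative is orthogonal to `h
x`. An invertible derivative would have `h x` in its range, giving R = 0. -/
theorem det_eq_zero_of_norm_eq {h : E → E} {R : ℝ} (hR : 0 < R) (hnorm : ∀ x, ‖h x‖ = R) {x : E}
    (hd : DifferentiableAt ℝ h x) : (fderiv ℝ h x).det = 0 := by
  by_contra hne
  have h1 : HasFDerivAt (fun y => inner ℝ (h y) (h y))
      (0 : E →L[ℝ] ℝ) x := by
    have : (fun y => inner ℝ (h y) (h y)) = fun _ => R ^ 2 := by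
      funext y; rw [real_inner_self_eq_norm_sq, hnorm]
    rw [this]; exact hasFDerivAt_const _ _
  have h2 := hd.hasFDerivAt.inner ℝ hd.hasFDerivAt
  have h3 := h1.unique h2
  set e := (fderiv ℝ h x).toContinuousLinearEquivOfDetNeZero hne with he
  have h4 : fderiv ℝ h x (e.symm (h x)) = h x := by
    have := e.apply_symm_apply (h x)
    rwa [he, ContinuousLinearMap.toContinuousLinearEquivOfDetNeZero_apply] at this
  have h5 := congrArg (fun L : E →L[ℝ] ℝ => L (e.symm (h x))) h3
  rw [ContinuousLinearMap.comp_apply, ContinuousLinearMap.prod_apply, h4, fderivInnerCLM_apply,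
    real_inner_self_eq_norm_sq, hnorm, zero_apply] at h5
  nlinarith

variable [MeasurableSpace E] [BorelSpace E]

/-- There is no continuously differentiable map to a sphere that fixes the points of the sphere. -/
theorem not_exists_retraction [Nontrivial E] {h : E → E} {R : ℝ} (hR : 0 < R)
    (hh : ContDiff ℝ 1 h) (hnorm : ∀ x, ‖h x‖ = R) (hfix : ∀ x, ‖x‖ = R → h x = x) : False := by
  classical
  set B : Set E := ball 0 R
  set A : E → E →L[ℝ] E := fun x => fderiv ℝ h x - ContinuousLinearMap.id ℝ E with hA
  have hAc : Continuous A := (hh.continuous_fderiv one_ne_zero).sub continuous_const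
  set J : ℝ → E → ℝ := fun t x => (ContinuousLinearMap.id ℝ E + t • A x).det with hJ
  have hJc : Continuous fun q : ℝ × E => J q.1 q.2 :=
    ContinuousLinearMap.continuous_det.comp
      (continuous_const.add (continuous_fst.smul (hAc.comp continuous_snd)))
  -- Since h fixes the sphere, h - id can be cut off there and stays Lipschitz. For small t, x + t
  -- g(x) is then a bijection of the whole space that is the identity outside the ball, so it maps
  -- the ball onto itself.
  set g : E → E := fun x => if ‖x‖ ≤ R then h x - x else 0 with hg
  have hg0 : ∀ x, R ≤ ‖x‖ → g x = 0 := by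
    intro x hx
    simp only [hg]
    split_ifs with hx'
    · rw [hfix x (le_antisymm hx' hx), sub_self]
    · rfl
  obtain ⟨K, hK⟩ : ∃ K, LipschitzOnWith K (fun x => h x - x) (closedBall (0 : E) R) := by
    have : ContDiff ℝ 1 (fun x => h x - x) := hh.sub contDiff_id
    exact (this.locallyLipschitz.locallyLipschitzOn).exists_lipschitzOnWith_of_compact
      (isCompact_closedBall _ _)
  have hgK : LipschitzWith K g := by
    refine lipschitzWith_of_closedBall (R := R) (fun x hx y hy => ?_) hg0
    simp only [mem_closedBall, dist_zero_right] at hx hy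
    simp only [hg, if_pos hx, if_pos hy]
    exact hK (by simpa using hx) (by simpa using hy)
  -- for small parameters the deformation is a diffeomorphism of the ball
  obtain ⟨δ, hδ, hδ'⟩ : ∃ δ > 0, ∀ t ∈ Set.Ioo (0 : ℝ) δ,
      ∫ x in B, J t x = (volume B).toReal := by
    have hev : ∀ᶠ t : ℝ in 𝓝 0, ∀ x ∈ closedBall (0 : E) R, 0 < J t x := by
      refine (isCompact_closedBall (0 : E) R).eventually_forall_of_forall_eventually fun x _ => ?_
      refine hJc.continuousAt.eventually_const_lt ?_
      simp [hJ, ContinuousLinearMap.det]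
    have hev2 : ∀ᶠ t : ℝ in 𝓝 0, t * K < 1 := by
      have : Continuous fun t : ℝ => t * (K : ℝ) := by fun_prop
      exact this.continuousAt.eventually_lt_const (by simp)
    obtain ⟨δ, hδ, hball⟩ := Metric.eventually_nhds_iff.1 (hev.and hev2)
    refine ⟨δ, hδ, fun t ht => ?_⟩
    obtain ⟨hpos, htK⟩ := hball (y := t) (by
      rw [Real.dist_eq, sub_zero, abs_of_pos ht.1]; exact ht.2)
    set φ : E → E := fun x => x + t • g x with hφ
    have hbij : Function.Bijective φ := by
      refine bijective_add_of_lipschitzWith (K := ‖t‖₊ * K) ?_ ((lipschitzWith_smul t).comp hgK)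
      rw [← NNReal.coe_lt_coe]
      simpa [abs_of_pos ht.1] using htK
    have hout : ∀ x, R ≤ ‖x‖ → φ x = x := fun x hx => by simp [hφ, hg0 x hx]
    have himg : φ '' B = B := by
      have hc : φ '' Bᶜ = Bᶜ := by
        have : Set.EqOn φ id Bᶜ := fun x hx => hout x (by simpa [B] using hx)
        rw [this.image_eq, Set.image_id]
      rw [Set.image_compl_eq hbij] at hc
      exact compl_injective hc
    have hder : ∀ x ∈ B, HasFDerivWithinAt φ (ContinuousLinearMap.id ℝ E + t • A x) B x := by
      intro x hx
      have h1 : HasFDerivAt (fun x => x + t • (h x - x))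
          (ContinuousLinearMap.id ℝ E + t • A x) x :=
        (hasFDerivAt_id x).add
          (((hh.differentiable one_ne_zero x).hasFDerivAt.sub (hasFDerivAt_id x)).const_smul t)
      refine h1.hasFDerivWithinAt.congr (fun y hy => ?_) ?_
      · have : ‖y‖ ≤ R := le_of_lt (by simpa [B] using hy)
        simp [hφ, hg, this]
      · have : ‖x‖ ≤ R := le_of_lt (by simpa [B] using hx)
        simp [hφ, hg, this]
    have hcv := integral_image_eq_integral_abs_det_fderiv_smul volume
      (measurableSet_ball : MeasurableSet B) hder hbij.1.injOn (fun _ => (1 : ℝ))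
    rw [himg] at hcv
    have h2 : ∫ x in B, (1 : ℝ) = (volume B).toReal := by simp [measureReal_def]
    rw [← h2, hcv]
    refine setIntegral_congr_fun measurableSet_ball fun x hx => ?_
    simp only [smul_eq_mul, mul_one]
    rw [abs_of_pos (hpos x (ball_subset_closedBall hx))]
  -- Interpolation carries the identity ∫ J t = vol B from small t to t = 1, where the integrand is
  -- the determinant of the derivative of h, which is 0.
  obtain ⟨v, c, hv, hc, hp⟩ := exists_eval_one_eq_sum (Module.finrank ℝ E) hδ
  have hJ1 : ∀ x, J 1 x = ∑ i, c i * J (v i) x := by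
    intro x
    obtain ⟨p, hpd, hpe⟩ := exists_polynomial_eval_eq_det (A x)
    simpa only [hpe] using hp p hpd
  have hint : ∀ t, IntegrableOn (J t) B := fun t =>
    ((hJc.comp (by fun_prop : Continuous fun x : E => (t, x))).continuousOn.integrableOn_compact
      (isCompact_closedBall (0 : E) R)).mono_set ball_subset_closedBall
  have htot : ∫ x in B, J 1 x = (volume B).toReal := by
    simp only [hJ1]
    rw [integral_finsetSum _ fun i _ => (hint (v i)).const_mul (c i)]
    simp only [integral_const_mul, hδ' _ (hv _), ← Finset.sum_mul, hc, one_mul]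
  have hzero : ∀ x, J 1 x = 0 := by
    intro x
    have : ContinuousLinearMap.id ℝ E + (1 : ℝ) • A x = fderiv ℝ h x := by simp [hA]
    simp only [hJ, this]
    exact det_eq_zero_of_norm_eq hR hnorm (hh.differentiable one_ne_zero x)
  simp only [hzero, integral_zero] at htot
  have hvol : 0 < (volume B).toReal :=
    ENNReal.toReal_pos (measure_ball_pos _ _ hR).ne' measure_ball_lt_top.ne
  linarith

/-- **Brouwer's fixed point theorem** for bounded continuously differentiable maps. -/
theorem exists_fixedPoint_of_contDiff {F : E → E} (hF : ContDiff ℝ 1 F) {C : ℝ}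
    (hC : ∀ x, ‖F x‖ ≤ C) : ∃ x, F x = x := by
  rcases subsingleton_or_nontrivial E with hE | hE
  · exact ⟨0, Subsingleton.elim _ _⟩
  by_contra! hne
  have hC0 : 0 ≤ C := (norm_nonneg _).trans (hC 0)
  -- The bump is 1 on the ball of radius C + 1, which contains every zero of Φ, and 0 on the sphere
  -- of radius C + 2, so Φ scaled to length C + 2 fixes that sphere.
  let η : ContDiffBump (0 : E) := ⟨C + 1, C + 2, by linarith, by linarith⟩
  set Φ : E → E := fun x => x - η x • F x with hΦ
  have hΦ0 : ∀ x, Φ x ≠ 0 := by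
    intro x hx
    have hx1 : x = η x • F x := sub_eq_zero.1 hx
    have hx2 : ‖x‖ ≤ C := by
      calc ‖x‖ = ‖η x • F x‖ := by rw [← hx1]
        _ = η x * ‖F x‖ := by rw [norm_smul, Real.norm_of_nonneg η.nonneg]
        _ ≤ 1 * C := mul_le_mul η.le_one (hC x) (norm_nonneg _) zero_le_one
        _ = C := one_mul C
    have hx3 : η x = 1 := η.one_of_mem_closedBall (by simp [η]; linarith)
    rw [hx3, one_smul] at hx1
    exact hne x hx1.symm
  have hΦc : ContDiff ℝ 1 Φ := contDiff_id.sub (η.contDiff.smul hF)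
  refine not_exists_retraction (R := C + 2) (h := fun x => ((C + 2) / ‖Φ x‖) • Φ x)
    (by linarith) ?_ ?_ ?_
  · refine ContDiff.smul (contDiff_const.div (hΦc.norm ℝ hΦ0) fun x => ?_) hΦc
    exact norm_ne_zero_iff.2 (hΦ0 x)
  · intro x
    have := norm_ne_zero_iff.2 (hΦ0 x)
    rw [norm_smul, norm_div, norm_norm, div_mul_cancel₀ _ this, Real.norm_of_nonneg (by linarith)]
  · intro x hx
    have h0 : η x = 0 := η.zero_of_le_dist (by simp [η, hx])
    have h1 : Φ x = x := by simp [hΦ, h0]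
    simp only [h1, hx]
    rw [div_self (by linarith), one_smul]

end Brouwer

end HypothesisTesting

/-! ### Concentration of the empirical frequencies -/

namespace HypothesisTesting

section Hoeffding

variable {Ω : Type*} [Fintype Ω]

open ProbabilityTheory in
/-- **Hoeffding's lemma** for finitely many outcomes. -/
theorem sum_mul_exp_le {w X : Ω → ℝ} (hw : w ∈ stdSimplex ℝ Ω) (hX : ∀ a, X a ∈ Set.Icc (0 : ℝ) 1)
    (s : ℝ) : ∑ a, w a * Real.exp (s * (X a - ∑ b, w b * X b)) ≤ Real.exp (s ^ 2 / 8) := by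
  let _ : MeasurableSpace Ω := ⊤
  have hp : ∑ a, ENNReal.ofReal (w a) = 1 := by
    rw [← ENNReal.ofReal_sum_of_nonneg fun a _ => hw.1 a, hw.2, ENNReal.ofReal_one]
  set p : PMF Ω := PMF.ofFintype (fun a => ENNReal.ofReal (w a)) hp with hpdef
  have hint : ∀ f : Ω → ℝ, ∫ a, f a ∂p.toMeasure = ∑ a, w a * f a := by
    intro f
    rw [PMF.integral_eq_sum]
    refine Finset.sum_congr rfl fun a _ => ?_
    rw [hpdef, PMF.ofFintype_apply, ENNReal.toReal_ofReal (hw.1 a), smul_eq_mul]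
  have h := (hasSubgaussianMGF_of_mem_Icc (μ := p.toMeasure) (X := X) (a := 0) (b := 1)
    (measurable_of_finite X).aemeasurable (Eventually.of_forall hX)).mgf_le s
  rw [mgf, hint, hint] at h
  refine h.trans_eq ?_
  congr 1
  norm_num
  ring

theorem sum_prod_mul_indicator_le {w X : Ω → ℝ} (hw : w ∈ stdSimplex ℝ Ω)
    (hX : ∀ a, X a ∈ Set.Icc (0 : ℝ) 1) (T : ℕ) {δ : ℝ} (hδ : 0 ≤ δ) :
    ∑ ω : Fin T → Ω, (∏ t, w (ω t)) *
      Set.indicator {ω : Fin T → Ω | T * δ ≤ ∑ t, (X (ω t) - ∑ b, w b * X b)} 1 ω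
      ≤ Real.exp (-2 * T * δ ^ 2) := by
  classical
  set m := ∑ b, w b * X b
  -- This choice minimizes s²/8 - sδ in the exponential Markov bound; the minimum is -2δ².
  set s : ℝ := 4 * δ
  calc ∑ ω : Fin T → Ω, (∏ t, w (ω t)) *
        Set.indicator {ω : Fin T → Ω | T * δ ≤ ∑ t, (X (ω t) - m)} 1 ω
      ≤ ∑ ω : Fin T → Ω, (∏ t, w (ω t)) *
          (Real.exp (-(s * (T * δ))) * ∏ t, Real.exp (s * (X (ω t) - m))) := by
        refine Finset.sum_le_sum fun ω _ =>
          mul_le_mul_of_nonneg_left ?_ (Finset.prod_nonneg fun t _ => hw.1 _)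
        rw [← Real.exp_sum, ← Real.exp_add]
        rw [Set.indicator_apply]
        split_ifs with hω
        · rw [Pi.one_apply, Real.one_le_exp_iff, ← Finset.mul_sum]
          have : s * (T * δ) ≤ s * ∑ t, (X (ω t) - m) :=
            mul_le_mul_of_nonneg_left hω (by positivity)
          linarith
        · positivity
    _ = Real.exp (-(s * (T * δ))) * ∏ _t : Fin T, ∑ a, w a * Real.exp (s * (X a - m)) := by
        rw [Finset.prod_univ_sum, Finset.mul_sum, Fintype.piFinset_univ]
        refine Finset.sum_congr rfl fun ω _ => ?_
        rw [Finset.prod_mul_distrib]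
        ring
    _ ≤ Real.exp (-(s * (T * δ))) * ∏ _t : Fin T, Real.exp (s ^ 2 / 8) := by
        refine mul_le_mul_of_nonneg_left (Finset.prod_le_prod (fun t _ => ?_)
          fun t _ => sum_mul_exp_le hw hX s) (Real.exp_pos _).le
        exact Finset.sum_nonneg fun a _ => mul_nonneg (hw.1 a) (Real.exp_pos _).le
    _ = Real.exp (-2 * T * δ ^ 2) := by
        rw [Finset.prod_const, Finset.card_univ, Fintype.card_fin, ← Real.exp_nat_mul,
          ← Real.exp_add]
        congr 1
        simp only [s]
        ring

/-- **Hoeffding's inequality** for the average of independent draws from finitely many outcomes. -/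
theorem sum_prod_mul_indicator_abs_le {w X : Ω → ℝ} (hw : w ∈ stdSimplex ℝ Ω)
    (hX : ∀ a, X a ∈ Set.Icc (0 : ℝ) 1) {T : ℕ} (hT : 0 < T) {δ : ℝ} (hδ : 0 ≤ δ) :
    ∑ ω : Fin T → Ω, (∏ t, w (ω t)) *
      Set.indicator {ω : Fin T → Ω | δ ≤ |1 / (T : ℝ) * ∑ t, X (ω t) - ∑ b, w b * X b|} 1 ω
      ≤ 2 * Real.exp (-2 * T * δ ^ 2) := by
  have h1 := sum_prod_mul_indicator_le hw hX T hδ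
  -- The lower tail of X is the upper tail of 1 - X.
  have h2 := sum_prod_mul_indicator_le hw (X := fun a => 1 - X a)
    (fun a => ⟨by linarith [(hX a).2], by linarith [(hX a).1]⟩) T hδ
  have hT' : (0 : ℝ) < T := by exact_mod_cast hT
  have hm : ∑ b, w b * (1 - X b) = 1 - ∑ b, w b * X b := by
    simp only [mul_sub, mul_one, Finset.sum_sub_distrib, hw.2]
  rw [hm] at h2
  set m := ∑ b, w b * X b
  rw [two_mul]
  refine le_trans ?_ (add_le_add h1 h2)
  rw [← Finset.sum_add_distrib]
  refine Finset.sum_le_sum fun ω _ => ?_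
  rw [← mul_add]
  refine mul_le_mul_of_nonneg_left ?_ (Finset.prod_nonneg fun t _ => hw.1 _)
  have hA : ∀ s : Set (Fin T → Ω), 0 ≤ Set.indicator s (1 : (Fin T → Ω) → ℝ) ω := fun s =>
    Set.indicator_nonneg (fun _ _ => zero_le_one) _
  have hmul : ∀ a : ℝ, δ ≤ 1 / (T : ℝ) * a - m → T * δ ≤ a - T * m := by
    intro a ha
    have := mul_le_mul_of_nonneg_left ha hT'.le
    rwa [mul_sub, ← mul_assoc, mul_one_div_cancel hT'.ne', one_mul] at this
  have hmul' : ∀ a : ℝ, δ ≤ -(1 / (T : ℝ) * a - m) → T * δ ≤ T * m - a := by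
    intro a ha
    have := mul_le_mul_of_nonneg_left ha hT'.le
    rwa [neg_sub, mul_sub, ← mul_assoc, mul_one_div_cancel hT'.ne', one_mul] at this
  by_cases h : δ ≤ |1 / (T : ℝ) * ∑ t, X (ω t) - m|
  · rw [Set.indicator_of_mem (by exact h)]
    rcases le_abs.1 h with h | h
    · refine le_add_of_le_of_nonneg (le_of_eq ?_) (hA _)
      rw [Set.indicator_of_mem]
      have := hmul _ h
      simpa [Finset.sum_sub_distrib] using this
    · refine le_add_of_nonneg_of_le (hA _) (le_of_eq ?_)
      rw [Set.indicator_of_mem]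
      have := hmul' _ h
      simp only [Set.mem_ofPred_eq, sub_sub_sub_cancel_left]
      simpa [Finset.sum_sub_distrib] using this
  · rw [Set.indicator_of_notMem (by exact h)]
    exact add_nonneg (hA _) (hA _)

end Hoeffding

/-! ### Euclidean distances of profiles -/

section Distances

theorem l2Dist_eq {ι : Type*} [Fintype ι] (p q : ι → ℝ) :
    l2Dist p q = √(∑ x, (p x - q x) ^ 2) := by
  simp [l2Dist, EuclideanSpace.dist_eq, Real.dist_eq, sq_abs]

variable {κ : Type*} [Fintype κ] {B : κ → Type*} [∀ k, Fintype (B k)]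

theorem profileDist_eq (p q : ∀ k, B k → ℝ) :
    profileDist p q = √(∑ x : (Σ k, B k), (p x.1 x.2 - q x.1 x.2) ^ 2) :=
  l2Dist_eq _ _

theorem profileDist_comm (p q : ∀ k, B k → ℝ) : profileDist p q = profileDist q p :=
  dist_comm _ _

theorem profileDist_triangle (p q r : ∀ k, B k → ℝ) :
    profileDist p r ≤ profileDist p q + profileDist q r :=
  dist_triangle _ _ _

theorem l2Dist_le_profileDist (p q : ∀ k, B k → ℝ) (k : κ) :
    l2Dist (p k) (q k) ≤ profileDist p q := by
  rw [l2Dist_eq, profileDist_eq]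
  refine Real.sqrt_le_sqrt ?_
  rw [Fintype.sum_sigma]
  exact Finset.single_le_sum (f := fun k => ∑ x, (p k x - q k x) ^ 2)
    (fun k _ => Finset.sum_nonneg fun x _ => sq_nonneg _) (Finset.mem_univ k)

theorem profileDist_le_sum (p q : ∀ k, B k → ℝ) :
    profileDist p q ≤ ∑ k, ∑ x, |p k x - q k x| := by
  rw [profileDist_eq, ← Fintype.sum_sigma' (fun k x => |p k x - q k x|)]
  refine Real.sqrt_le_iff.2 ⟨Finset.sum_nonneg fun x _ => abs_nonneg _, ?_⟩
  simp only [← sq_abs (p _ _ - q _ _)]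
  exact Finset.sum_sq_le_sq_sum_of_nonneg fun x _ => abs_nonneg _

end Distances

/-- The concatenated vector of the opponents has Σ|A_j| coordinates, while the test threshold
contains |A_{-i}| = Π|A_j|. The bound needs at least two actions for each player. -/
theorem sum_card_le_prod_card {κ : Type*} (s : Finset κ) (n : κ → ℕ) (hn : ∀ k, 2 ≤ n k) :
    ∑ k ∈ s, n k ≤ ∏ k ∈ s, n k := by
  classical
  induction s using Finset.induction with
  | empty => simp
  | insert k s hk ih =>
    rw [Finset.sum_insert hk, Finset.prod_insert hk]
    rcases s.eq_empty_or_nonempty with rfl | ⟨l, hl⟩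
    · simp
    · have h1 : 2 ≤ ∏ k ∈ s, n k :=
        (hn l).trans (Nat.le_of_dvd (Finset.prod_pos fun k _ => by have := hn k; omega)
          (Finset.dvd_prod_of_mem n hl))
      have h2 := hn k
      nlinarith

theorem sampleProb_nonneg {I : Type*} [Fintype I] {A : I → Type*} [∀ i, Fintype (A i)] {T : ℕ} {π : ∀ j, A j → ℝ} (hπ : ∀ j, π j ∈ stdSimplex ℝ (A j))
    (ω : Fin T → ∀ j, A j) : 0 ≤ sampleProb π ω :=
  Finset.prod_nonneg fun _ _ => Finset.prod_nonneg fun j _ => (hπ j).1 _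

/-! ### Empirical play of independent opponents -/

section Game

variable {I : Type*} [Fintype I] [DecidableEq I] {A : I → Type*} [∀ i, Fintype (A i)]

theorem prod_mem_stdSimplex {κ : Type*} [Fintype κ] [DecidableEq κ] {B : κ → Type*}
    [∀ k, Fintype (B k)] {π : ∀ k, B k → ℝ} (hπ : ∀ k, π k ∈ stdSimplex ℝ (B k)) :
    (fun a : (∀ k, B k) => ∏ k, π k (a k)) ∈ stdSimplex ℝ (∀ k, B k) := by
  refine ⟨fun a => Finset.prod_nonneg fun k _ => (hπ k).1 _, ?_⟩
  have := Finset.prod_univ_sum (fun k => (Finset.univ : Finset (B k))) (fun k x => π k x)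
  rw [Fintype.piFinset_univ] at this
  rw [← this]
  exact Finset.prod_eq_one fun k _ => (hπ k).2

open Classical in
theorem sum_prod_mul_ite_eq {π : ∀ j, A j → ℝ} (hπ : ∀ j, π j ∈ stdSimplex ℝ (A j)) (i : I)
    (x : A i) : ∑ a : (∀ j, A j), (∏ j, π j (a j)) * (if a i = x then 1 else 0) = π i x := by
  -- The indicator of `a i = x` is written as a product over all players, with factor 1 away from i,
  -- so that the sum over profiles factorizes.
  have h := Finset.prod_univ_sum (fun k => (Finset.univ : Finset (A k)))
    (fun k y => π k y * if h : k = i then (if h ▸ y = x then 1 else 0) else 1)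
  rw [Fintype.piFinset_univ] at h
  have h1 : ∀ a : (∀ j, A j), ∏ k, (π k (a k) *
      if h : k = i then (if h ▸ a k = x then (1 : ℝ) else 0) else 1)
      = (∏ j, π j (a j)) * (if a i = x then 1 else 0) := by
    intro a
    rw [Finset.prod_mul_distrib]
    congr 1
    rw [Finset.prod_eq_single i (fun k _ hk => by simp [hk]) (by simp)]
    simp
  rw [Finset.sum_congr rfl fun a _ => h1 a] at h
  rw [← h, Finset.prod_eq_single i]
  · simp
  · intro k _ hk
    simpa [hk] using (hπ k).2
  · simp

theorem sum_sampleProb {T : ℕ} {π : ∀ j, A j → ℝ} (hπ : ∀ j, π j ∈ stdSimplex ℝ (A j)) :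
    ∑ ω : Fin T → ∀ j, A j, sampleProb π ω = 1 :=
  (prod_mem_stdSimplex (κ := Fin T) fun _ => prod_mem_stdSimplex hπ).2

/-- If the empirical profile is far from `q`, so is the empirical frequency of some action. -/
theorem exists_le_abs_empirical_sub [∀ i, Nontrivial (A i)] {α : ℝ} (hα : α ∈ Set.Ioo (0 : ℝ) 1)
    {T : ℕ} (hT : 0 < T) (ω : Fin T → ∀ j, A j) (i : I) (q : ∀ j : {j // j ≠ i}, A j → ℝ)
    (h : √((oppActions A i : ℝ) / (2 * (T : ℝ)) * Real.log (2 / α))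
      ≤ profileDist (empirical ω i) q) :
    ∃ x : (Σ j : {j // j ≠ i}, A j),
      √(Real.log (2 / α) / (2 * T)) ≤ |empirical ω i x.1 x.2 - q x.1 x.2| := by
  by_contra! hcon
  have hT' : (0 : ℝ) < T := by exact_mod_cast hT
  have hlog : 0 < Real.log (2 / α) := Real.log_pos (by rw [lt_div_iff₀ hα.1]; linarith [hα.2])
  have hc : 0 < Real.log (2 / α) / (2 * T) := by positivity
  have hcard : Fintype.card (Σ j : {j // j ≠ i}, A j) ≤ oppActions A i := by
    rw [oppActions, Fintype.card_sigma, Fintype.card_pi]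
    exact sum_card_le_prod_card _ _ fun j => Fintype.one_lt_card
  have hopp : 0 < oppActions A i := Fintype.card_pos_iff.2 ⟨fun j => Classical.arbitrary _⟩
  rw [profileDist_eq] at h
  have h1 := (Real.sqrt_le_sqrt_iff (Finset.sum_nonneg fun x _ => sq_nonneg _)).1 h
  have h2 : ∀ x : (Σ j : {j // j ≠ i}, A j),
      (empirical ω i x.1 x.2 - q x.1 x.2) ^ 2 < Real.log (2 / α) / (2 * T) := by
    intro x
    rw [← sq_abs]
    exact (Real.lt_sqrt (abs_nonneg _)).1 (hcon x)
  have h3 : (oppActions A i : ℝ) / (2 * (T : ℝ)) * Real.log (2 / α)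
      = oppActions A i * (Real.log (2 / α) / (2 * T)) := by ring
  rw [h3] at h1
  refine absurd h1 (not_le.2 ?_)
  rcases isEmpty_or_nonempty (Σ j : {j // j ≠ i}, A j) with he | he
  · rw [Fintype.sum_empty]
    positivity
  · calc ∑ x : (Σ j : {j // j ≠ i}, A j), (empirical ω i x.1 x.2 - q x.1 x.2) ^ 2
        < ∑ _x : (Σ j : {j // j ≠ i}, A j), Real.log (2 / α) / (2 * T) :=
          Finset.sum_lt_sum_of_nonempty Finset.univ_nonempty fun x _ => h2 x
      _ = Fintype.card (Σ j : {j // j ≠ i}, A j) * (Real.log (2 / α) / (2 * T)) := by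
          rw [Finset.sum_const, nsmul_eq_mul, Finset.card_univ]
      _ ≤ _ := mul_le_mul_of_nonneg_right (by exact_mod_cast hcard) hc.le

/-- The probability that the empirical profile of the opponents of `i` is far from their
strategies. -/
theorem sum_sampleProb_indicator_le [∀ i, Nontrivial (A i)] {α : ℝ} (hα : α ∈ Set.Ioo (0 : ℝ) 1)
    {T : ℕ} (hT : 0 < T) {π : ∀ j, A j → ℝ} (hπ : ∀ j, π j ∈ stdSimplex ℝ (A j)) (i : I) :
    ∑ ω : Fin T → ∀ j, A j, sampleProb π ω *
      Set.indicator {ω : Fin T → ∀ j, A j |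
        √((oppActions A i : ℝ) / (2 * (T : ℝ)) * Real.log (2 / α))
          ≤ profileDist (empirical ω i) (fun j : {j // j ≠ i} => π j)} 1 ω
      ≤ Fintype.card (Σ j : {j // j ≠ i}, A j) * α := by
  classical
  have hT' : (0 : ℝ) < T := by exact_mod_cast hT
  have hlog : 0 < Real.log (2 / α) := Real.log_pos (by rw [lt_div_iff₀ hα.1]; linarith [hα.2])
  set δ := √(Real.log (2 / α) / (2 * T)) with hδ
  -- δ is chosen so that Hoeffding's bound 2 exp(-2Tδ²) equals α. A union bound over the coordinates
  -- then finishes the proof.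
  have htail : ∀ x : (Σ j : {j // j ≠ i}, A j),
      ∑ ω : Fin T → ∀ j, A j, sampleProb π ω *
        Set.indicator {ω : Fin T → ∀ j, A j | δ ≤ |empirical ω i x.1 x.2 - π x.1 x.2|} 1 ω
        ≤ α := by
    intro x
    have h := sum_prod_mul_indicator_abs_le (prod_mem_stdSimplex hπ)
      (X := fun a => if a x.1 = x.2 then 1 else 0) (fun a => by split_ifs <;> simp) hT
      (δ := δ) (Real.sqrt_nonneg _)
    rw [sum_prod_mul_ite_eq hπ] at h
    refine h.trans_eq ?_
    rw [hδ, Real.sq_sqrt (by positivity)]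
    have h1 : -2 * (T : ℝ) * (Real.log (2 / α) / (2 * T)) = -Real.log (2 / α) := by
      field_simp
    rw [h1, Real.exp_neg, Real.exp_log (by have := hα.1; positivity)]
    have := hα.1.ne'
    field_simp
  calc _ ≤ ∑ ω : Fin T → ∀ j, A j, ∑ x : (Σ j : {j // j ≠ i}, A j), sampleProb π ω *
        Set.indicator {ω : Fin T → ∀ j, A j | δ ≤ |empirical ω i x.1 x.2 - π x.1 x.2|} 1 ω := by
        refine Finset.sum_le_sum fun ω _ => ?_
        rw [← Finset.mul_sum]
        refine mul_le_mul_of_nonneg_left ?_ (sampleProb_nonneg hπ ω)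
        have hnn : ∀ x ∈ (Finset.univ : Finset (Σ j : {j // j ≠ i}, A j)), 0 ≤ Set.indicator
            {ω : Fin T → ∀ j, A j | δ ≤ |empirical ω i x.1 x.2 - π x.1 x.2|}
            (1 : (Fin T → ∀ j, A j) → ℝ) ω :=
          fun x _ => Set.indicator_nonneg (fun _ _ => zero_le_one) _
        by_cases h : √((oppActions A i : ℝ) / (2 * (T : ℝ)) * Real.log (2 / α))
            ≤ profileDist (empirical ω i) (fun j : {j // j ≠ i} => π j)
        · obtain ⟨x, hx⟩ := exists_le_abs_empirical_sub hα hT ω i _ h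
          rw [Set.indicator_of_mem (by exact h)]
          refine le_trans (le_of_eq ?_) (Finset.single_le_sum hnn (Finset.mem_univ x))
          rw [Set.indicator_of_mem (by exact hx)]
        · rw [Set.indicator_of_notMem (by exact h)]
          exact Finset.sum_nonneg hnn
    _ ≤ ∑ _x : (Σ j : {j // j ≠ i}, A j), α := by
        rw [Finset.sum_comm]
        exact Finset.sum_le_sum fun x _ => htail x
    _ = _ := by rw [Finset.sum_const, nsmul_eq_mul, Finset.card_univ]

end Game

end HypothesisTesting

/-! ### Asymptotics of the transition probabilities -/

namespace HypothesisTesting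

theorem tendsto_rpow_nhdsGT_zero {a : ℝ} (ha : 0 ≤ a) :
    Tendsto (fun ξ : ℝ => ξ ^ a) (𝓝[>] 0) (𝓝 (0 ^ a)) :=
  (Real.continuousAt_rpow_const 0 a (Or.inr ha)).tendsto.mono_left nhdsWithin_le_nhds

/-- Replacing the factors one at a time, each replacement costs a multiple of ξ^{g i}, which is at
most of order ξ^c. When g i = c, the limit `0 ^ 0 = 1` retains the term. -/
theorem exists_tendsto_prod_sub_div {I : Type*} (s : Finset I) (g p e : I → ℝ) {c : ℝ}
    (hc : 0 ≤ c) (hg : ∀ i, c ≤ g i) :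
    ∃ l, Tendsto (fun ξ : ℝ => (∏ i ∈ s, (p i + ξ ^ g i * e i) - ∏ i ∈ s, p i) / ξ ^ c)
      (𝓝[>] 0) (𝓝 l) := by
  classical
  induction s using Finset.induction with
  | empty => exact ⟨0, by simp⟩
  | insert k s hk ih =>
    obtain ⟨l, hl⟩ := ih
    have h1 : Tendsto (fun ξ : ℝ => ∏ i ∈ s, (p i + ξ ^ g i * e i)) (𝓝[>] 0)
        (𝓝 (∏ i ∈ s, (p i + 0 ^ g i * e i))) :=
      tendsto_finsetProd _ fun i _ => tendsto_const_nhds.add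
        ((tendsto_rpow_nhdsGT_zero (hc.trans (hg i))).mul_const _)
    have h2 := tendsto_rpow_nhdsGT_zero (sub_nonneg.2 (hg k))
    refine ⟨_, ((hl.const_mul (p k)).add ((h2.mul_const (e k)).mul h1)).congr' ?_⟩
    filter_upwards [eventually_mem_nhdsWithin] with ξ hξ
    have hξ' : (0 : ℝ) < ξ := hξ
    have := (Real.rpow_pos_of_pos hξ' c).ne'
    rw [Finset.prod_insert hk, Finset.prod_insert hk, Real.rpow_sub hξ']
    field_simp
    ring

variable {I : Type*} [Fintype I] [DecidableEq I] {A : I → Type*} [∀ i, Fintype (A i)]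
  {u : I → (∀ j, A j) → ℝ} {σ τ : ℝ} {M : ℕ}

theorem smoothBR_pos (u : I → (∀ j, A j) → ℝ) (σ : ℝ) (i : I) [Nonempty (A i)]
    (y : ∀ j : {j // j ≠ i}, A j → ℝ) (x : A i) : 0 < smoothBR u σ i y x :=
  div_pos (Real.exp_pos _) (Finset.sum_pos (fun _ _ => Real.exp_pos _) Finset.univ_nonempty)

theorem smoothBR_mem_stdSimplex (u : I → (∀ j, A j) → ℝ) (σ : ℝ) (i : I) [Nonempty (A i)]
    (y : ∀ j : {j // j ≠ i}, A j → ℝ) : smoothBR u σ i y ∈ stdSimplex ℝ (A i) := by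
  refine ⟨fun x => (smoothBR_pos u σ i y x).le, ?_⟩
  simp only [smoothBR, ← Finset.sum_div]
  exact div_self (Finset.sum_pos (fun _ _ => Real.exp_pos _) Finset.univ_nonempty).ne'

namespace State

/-- The state in which the beliefs are `b`. -/
noncomputable def ofBelief (u : I → (∀ j, A j) → ℝ) (σ : ℝ) {M : ℕ} (b : ∀ i, Belief A M i) : State u σ M :=
  ⟨b, fun i => smoothBR u σ i (b i).vec, fun _ => rfl⟩

theorem belief_injective : Function.Injective (State.belief : State u σ M → _) := by
  intro z w h
  refine State.ext h (funext fun i => ?_)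
  rw [z.strategy_eq, w.strategy_eq, h]

/-- A state is determined by its beliefs. -/
noncomputable def equivBelief (u : I → (∀ j, A j) → ℝ) (σ : ℝ) (M : ℕ) :
    State u σ M ≃ ∀ i, Belief A M i where
  toFun := State.belief
  invFun := ofBelief u σ
  left_inv _ := belief_injective rfl
  right_inv _ := rfl

theorem strategy_mem_stdSimplex [∀ i, Nonempty (A i)] (z : State u σ M) (i : I) :
    z.strategy i ∈ stdSimplex ℝ (A i) := by
  rw [z.strategy_eq]
  exact smoothBR_mem_stdSimplex u σ i _

theorem joinAt_mem_stdSimplex [∀ i, Nonempty (A i)] (z : State u σ M) (i j : I) :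
    joinAt (β := fun j => A j → ℝ) i (z.strategy i) (z.belief i).vec j ∈ stdSimplex ℝ (A j) := by
  by_cases h : j = i
  · subst h
    simpa [joinAt, Equiv.piSplitAt_symm_apply] using z.strategy_mem_stdSimplex j
  · simpa [joinAt, Equiv.piSplitAt_symm_apply, h, Belief.vec] using (z.belief i ⟨j, h⟩).2.1

end State

/-- If beliefs can be destabilized, every player has an opponent. -/
theorem HasDestabilizingBeliefs.nonempty_ne (hbad : HasDestabilizingBeliefs u σ τ M) (hτ : 0 < τ)
    (z : State u σ M) (i : I) : Nonempty {j // j ≠ i} := by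
  by_contra he
  rw [not_nonempty_iff] at he
  obtain ⟨c, hc, -⟩ := hbad i fun j => z.belief j
  rw [profileDist_eq, Fintype.sum_empty, Real.sqrt_zero] at hc
  linarith

/-- If beliefs can be destabilized, there are no players with a single action. -/
theorem HasDestabilizingBeliefs.nontrivial [∀ i, Nonempty (A i)]
    (hbad : HasDestabilizingBeliefs u σ τ M) (hτ : 0 < τ) (z : State u σ M) (i : I) :
    Nontrivial (A i) := by
  by_contra hcon
  rw [not_nontrivial_iff_subsingleton] at hcon
  obtain ⟨c, -, hc⟩ := hbad i fun j => z.belief j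
  obtain ⟨j⟩ := hbad.nonempty_ne hτ z i
  have h1 := hc j
  -- On a single action there is only one probability vector, so no smooth best response can differ
  -- from a belief.
  have h2 : smoothBR u σ i c.vec = (z.belief j).vec ⟨i, j.2.symm⟩ := by
    have : Unique (A i) := ⟨⟨Classical.arbitrary _⟩, fun _ => Subsingleton.elim _ _⟩
    have ha := (smoothBR_mem_stdSimplex u σ i c.vec).2
    have hb := ((z.belief j) ⟨i, j.2.symm⟩).2.1.2
    rw [Fintype.sum_unique] at ha hb
    funext x
    rw [Subsingleton.elim x default, ha]
    exact hb.symm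
  rw [h2, l2Dist, dist_self] at h1
  linarith

/-! ### Transition probabilities and their leading order -/

namespace LearningRule

variable (L : LearningRule u σ τ M)

open Classical in
/-- The exponent of the exploration parameter in the probability that a testing player resamples. -/
noncomputable def exponent (z : State u σ M) (i : I) : ℝ :=
  if profileDist (z.belief i).vec (z.others i) ≤ τ then L.f i (z.utility i) else 0

/-- The exponent of the exploration parameter in the probability that a state is left. -/
noncomputable def cost (z : State u σ M) : ℝ := ⨅ i, L.exponent z i

open Classical in
/-- The indicator of the event that player `i` has the same belief in two states. -/
noncomputable def same (z z' : State u σ M) (i : I) : ℝ := if z'.belief i = z.belief i then 1 else 0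

/-- The probability that player `i` moves to the belief held in `z'` if a testing player resamples
with probability `r`. -/
noncomputable def moveProb (z z' : State u σ M) (i : I) (r : ℝ) : ℝ :=
  same z z' i + r * (L.γ i * (L.ψ i (z.belief i) (z'.belief i) - same z z' i))

theorem updateProb_eq (ξ : ℝ) (z z' : State u σ M) {T : ℕ} (ω : Fin T → ∀ j, A j) (i : I) :
    L.updateProb ξ z ω i (z'.belief i) = L.moveProb z z' i (L.resampleProb ξ z ω i) := by
  simp only [updateProb, moveProb, same]
  ring

theorem same_mem_Icc (z z' : State u σ M) (i : I) : same z z' i ∈ Set.Icc (0 : ℝ) 1 := by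
  rw [same]
  split_ifs <;> simp

theorem prod_same (z z' : State u σ M) [Decidable (z = z')] :
    ∏ i, same z z' i = if z = z' then 1 else 0 := by
  split_ifs with h
  · subst h; simp [same]
  · obtain ⟨i, hi⟩ : ∃ i, z'.belief i ≠ z.belief i := by
      by_contra! hcon
      exact h (State.belief_injective (funext hcon).symm)
    exact Finset.prod_eq_zero (Finset.mem_univ i) (by simp [same, hi])

theorem ψ_le_one (i : I) (b b' : Belief A M i) : L.ψ i b b' ≤ 1 := by
  rw [← L.sum_ψ i b]
  exact Finset.single_le_sum (f := fun b' => L.ψ i b b')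
    (fun b' _ => L.lam_pos.le.trans (L.lam_le i b b')) (Finset.mem_univ b')

theorem mul_le_moveProb (z z' : State u σ M) (i : I) {r : ℝ} (hr : r ∈ Set.Icc (0 : ℝ) 1) :
    r * L.γ i * L.lam ≤ L.moveProb z z' i r := by
  have h1 := (same_mem_Icc z z' i).1
  have h2 : r * L.γ i ≤ 1 := mul_le_one₀ hr.2 (L.γ_pos i).le (L.γ_le_one i)
  have h3 := mul_le_mul_of_nonneg_left (L.lam_le i (z.belief i) (z'.belief i))
    (mul_nonneg hr.1 (L.γ_pos i).le)
  have h4 := mul_nonneg h1 (sub_nonneg.2 h2)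
  rw [moveProb]
  linarith

/-- The bound is uniform in r because resampling may return the present belief: (1 - rγ) + rγψ ≥ ψ ≥
λ. -/
theorem lam_le_moveProb (z z' : State u σ M) (i : I) {r : ℝ} (hr : r ∈ Set.Icc (0 : ℝ) 1)
    (h : z'.belief i = z.belief i) : L.lam ≤ L.moveProb z z' i r := by
  have h2 : r * L.γ i ≤ 1 := mul_le_one₀ hr.2 (L.γ_pos i).le (L.γ_le_one i)
  have h3 := L.ψ_le_one i (z.belief i) (z'.belief i)
  have h4 := L.lam_le i (z.belief i) (z'.belief i)
  have h5 := mul_nonneg (sub_nonneg.2 h3) (sub_nonneg.2 h2)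
  rw [moveProb, same, if_pos h]
  linarith

theorem moveProb_mem_Icc (z z' : State u σ M) (i : I) {r : ℝ} (hr : r ∈ Set.Icc (0 : ℝ) 1) :
    L.moveProb z z' i r ∈ Set.Icc (0 : ℝ) 1 := by
  have h0 := same_mem_Icc z z' i
  have h1 := mul_nonneg hr.1 (L.γ_pos i).le
  have h2 : r * L.γ i ≤ 1 := mul_le_one₀ hr.2 (L.γ_pos i).le (L.γ_le_one i)
  refine ⟨(mul_nonneg h1 L.lam_pos.le).trans (L.mul_le_moveProb z z' i hr), ?_⟩
  have h3 := mul_le_mul_of_nonneg_left (L.ψ_le_one i (z.belief i) (z'.belief i)) h1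
  have h4 := mul_le_mul_of_nonneg_right h0.2 (sub_nonneg.2 h2)
  rw [moveProb]
  linarith

theorem rpow_mem_Icc {ξ a : ℝ} (hξ : ξ ∈ Set.Ioo (0 : ℝ) 1) (ha : 0 ≤ a) :
    ξ ^ a ∈ Set.Icc (0 : ℝ) 1 :=
  ⟨(Real.rpow_pos_of_pos hξ.1 _).le, Real.rpow_le_one hξ.1.le hξ.2.le ha⟩

theorem resampleProb_pos {ξ : ℝ} (hξ : ξ ∈ Set.Ioo (0 : ℝ) 1) (z : State u σ M) {T : ℕ}
    (ω : Fin T → ∀ j, A j) (i : I) : 0 < L.resampleProb ξ z ω i := by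
  rw [resampleProb]
  split_ifs
  · exact one_pos
  · exact Real.rpow_pos_of_pos hξ.1 _

theorem resampleProb_mem_Icc {ξ : ℝ} (hξ : ξ ∈ Set.Ioo (0 : ℝ) 1) (z : State u σ M) {T : ℕ}
    (ω : Fin T → ∀ j, A j) (i : I) : L.resampleProb ξ z ω i ∈ Set.Icc (0 : ℝ) 1 := by
  rw [resampleProb]
  split_ifs
  · simp
  · exact rpow_mem_Icc hξ (L.f_pos _ _).le

theorem exponent_nonneg (z : State u σ M) (i : I) : 0 ≤ L.exponent z i := by
  rw [exponent]
  split_ifs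
  · exact (L.f_pos _ _).le
  · exact le_rfl

theorem cost_le (z : State u σ M) (i : I) : L.cost z ≤ L.exponent z i :=
  ciInf_le (Set.finite_range _).bddBelow i

theorem cost_nonneg (z : State u σ M) : 0 ≤ L.cost z :=
  Real.iInf_nonneg fun i => L.exponent_nonneg z i

section

variable [∀ i, Nonempty (A i)]

/-- The anticipated utility is the expected utility at the mixed profile (π_i, b_i), and the other
summands in the bound are positive. -/
theorem f_utility_lt_ubar (z : State u σ M) (i : I) : L.f i (z.utility i) < L.ubar :=
  (Finset.single_le_sum (f := fun j => L.f j (expectedUtility u j _))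
    (fun j _ => (L.f_pos j _).le) (Finset.mem_univ i)).trans_lt
      (L.sum_lt_ubar _ fun j => z.joinAt_mem_stdSimplex i j)

theorem ubar_pos [Nonempty I] (z : State u σ M) : 0 < L.ubar :=
  (L.f_pos (Classical.arbitrary I) _).trans (L.f_utility_lt_ubar z _)

theorem cost_lt_ubar [Nonempty I] (z : State u σ M) : L.cost z < L.ubar := by
  refine (L.cost_le z (Classical.arbitrary I)).trans_lt ?_
  rw [exponent]
  split_ifs
  · exact L.f_utility_lt_ubar z _
  · exact L.ubar_pos z

theorem level_mem_Ioo [Nonempty I] (z : State u σ M) {ξ : ℝ} (hξ : ξ ∈ Set.Ioo (0 : ℝ) 1) :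
    L.level ξ ∈ Set.Ioo (0 : ℝ) 1 :=
  ⟨Real.rpow_pos_of_pos hξ.1 _, Real.rpow_lt_one hξ.1.le hξ.2 (L.ubar_pos z)⟩

theorem transition_pos {ξ : ℝ} (hξ : ξ ∈ Set.Ioo (0 : ℝ) 1) (z z' : State u σ M) :
    0 < L.transition ξ z z' := by
  refine Finset.sum_pos (fun ω _ => mul_pos (Finset.prod_pos fun t _ =>
    Finset.prod_pos fun j _ => ?_) (Finset.prod_pos fun i _ => ?_)) Finset.univ_nonempty
  · rw [z.strategy_eq]
    exact smoothBR_pos u σ j _ _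
  · rw [updateProb_eq]
    exact (mul_pos (mul_pos (L.resampleProb_pos hξ z ω i) (L.γ_pos i)) L.lam_pos).trans_le
      (L.mul_le_moveProb z z' i (L.resampleProb_mem_Icc hξ z ω i))

theorem sum_transition (ξ : ℝ) (z : State u σ M) : ∑ z', L.transition ξ z z' = 1 := by
  classical
  have h : ∀ ω : Fin (L.T (L.level ξ)) → ∀ j, A j,
      ∑ z' : State u σ M, ∏ i, L.updateProb ξ z ω i (z'.belief i) = 1 := by
    intro ω
    -- States correspond to belief profiles, so the sum over them factorizes over the players.
    refine ((State.equivBelief u σ M).sum_comp fun b => ∏ i, L.updateProb ξ z ω i (b i)).trans ?_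
    have := Finset.prod_univ_sum (fun i => (Finset.univ : Finset (Belief A M i)))
      fun i c => L.updateProb ξ z ω i c
    rw [Fintype.piFinset_univ] at this
    rw [← this]
    refine Finset.prod_eq_one fun i _ => ?_
    simp only [updateProb, Finset.sum_add_distrib, ← Finset.mul_sum, L.sum_ψ]
    simp
  simp only [transition]
  rw [Finset.sum_comm]
  simp only [← Finset.mul_sum, h, mul_one]
  exact sum_sampleProb z.strategy_mem_stdSimplex

/-- The transition probabilities if all tests give the correct result. -/
noncomputable def idealTransition (ξ : ℝ) (z z' : State u σ M) : ℝ :=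
  ∏ i, L.moveProb z z' i (ξ ^ L.exponent z i)

/-- A test can only give the wrong result if the empirical frequencies are atypical. -/
theorem resampleProb_eq [Nonempty I] {ξ : ℝ} (hξ : ξ ∈ Set.Ioo (0 : ℝ) 1) (z : State u σ M)
    (ω : Fin (L.T (L.level ξ)) → ∀ j, A j) (i : I)
    (hω : profileDist (empirical ω i) (z.others i) <
      √((oppActions A i : ℝ) / (2 * (L.T (L.level ξ) : ℝ)) * Real.log (2 / L.level ξ))) :
    L.resampleProb ξ z ω i = ξ ^ L.exponent z i := by
  have hα := L.level_mem_Ioo z hξ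
  have hT := L.T_pos _ hα
  have hlT := L.le_T _ hα i (z.belief i) z
  set r := √((oppActions A i : ℝ) / (2 * (L.T (L.level ξ) : ℝ)) * Real.log (2 / L.level ξ)) with hr
  have hT' : (0 : ℝ) < L.T (L.level ξ) := by exact_mod_cast hT
  have htri1 := profileDist_triangle (empirical ω i) (z.others i) (z.belief i).vec
  have htri2 := profileDist_triangle (z.others i) (empirical ω i) (z.belief i).vec
  rw [profileDist_comm (z.others i) (empirical ω i)] at htri2
  rw [resampleProb, exponent, profileDist_comm (z.belief i).vec]
  by_cases h : profileDist (z.others i) (z.belief i).vec ≤ τ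
  · rw [if_pos h, if_neg]
    rw [Rejects, not_lt]
    linarith
  · rw [if_neg h, Real.rpow_zero, if_pos]
    rw [not_le] at h
    have h1 := hlT h
    set D := profileDist (z.others i) (z.belief i).vec - τ with hD
    have hDpos : 0 < D := sub_pos.2 h
    -- This is what the sample size is for: the true distance is τ + D, so the empirical one exceeds
    -- τ + D - r ≥ τ + r and the test rejects.
    have h2 : r ≤ D / 2 := by
      rw [hr]
      refine Real.sqrt_le_iff.2 ⟨by positivity, ?_⟩
      rw [div_mul_eq_mul_div, div_le_iff₀ (by positivity)] at h1 ⊢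
      nlinarith
    rw [Rejects]
    linarith

/-- The two products agree unless some player sees atypical frequencies, and as both lie in [0, 1]
they then differ by at most 1. The union bound over players needs no independence of their tests,
which use the same play. -/
theorem abs_transition_sub_idealTransition_le [Nonempty I] [∀ i, Nontrivial (A i)] {ξ : ℝ}
    (hξ : ξ ∈ Set.Ioo (0 : ℝ) 1) (z z' : State u σ M) :
    |L.transition ξ z z' - L.idealTransition ξ z z'| ≤
      (∑ i : I, (Fintype.card (Σ j : {j // j ≠ i}, A j) : ℝ)) * ξ ^ L.ubar := by
  have hα := L.level_mem_Ioo z hξ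
  have hT := L.T_pos _ hα
  set α := L.level ξ
  set D : I → Set (Fin (L.T α) → ∀ j, A j) := fun i =>
    {ω | √((oppActions A i : ℝ) / (2 * (L.T α : ℝ)) * Real.log (2 / α))
          ≤ profileDist (empirical ω i) (fun j : {j // j ≠ i} => z.strategy j)}
  have hideal : L.idealTransition ξ z z' =
      ∑ ω : Fin (L.T α) → ∀ j, A j, sampleProb z.strategy ω * L.idealTransition ξ z z' := by
    rw [← Finset.sum_mul, sum_sampleProb z.strategy_mem_stdSimplex, one_mul]
  have hprod : ∀ r : I → ℝ, (∀ i, r i ∈ Set.Icc (0 : ℝ) 1) →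
      ∏ i, L.moveProb z z' i (r i) ∈ Set.Icc (0 : ℝ) 1 := fun r hr =>
    ⟨Finset.prod_nonneg fun i _ => (L.moveProb_mem_Icc z z' i (hr i)).1,
      Finset.prod_le_one (fun i _ => (L.moveProb_mem_Icc z z' i (hr i)).1)
        fun i _ => (L.moveProb_mem_Icc z z' i (hr i)).2⟩
  rw [hideal, transition, ← Finset.sum_sub_distrib, Finset.sum_mul]
  calc _ ≤ ∑ ω : Fin (L.T α) → ∀ j, A j,
        ∑ i, sampleProb z.strategy ω * Set.indicator (D i) 1 ω := by
        refine (Finset.abs_sum_le_sum_abs _ _).trans (Finset.sum_le_sum fun ω _ => ?_)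
        rw [← mul_sub, abs_mul, abs_of_nonneg (sampleProb_nonneg z.strategy_mem_stdSimplex ω),
          ← Finset.mul_sum]
        refine mul_le_mul_of_nonneg_left ?_ (sampleProb_nonneg z.strategy_mem_stdSimplex ω)
        have hnn : ∀ i ∈ (Finset.univ : Finset I), 0 ≤ Set.indicator (D i)
            (1 : (Fin (L.T α) → ∀ j, A j) → ℝ) ω :=
          fun i _ => Set.indicator_nonneg (fun _ _ => zero_le_one) _
        simp only [updateProb_eq]
        by_cases h : ∃ i, ω ∈ D i
        · obtain ⟨i, hi⟩ := h
          refine le_trans ?_ (Finset.single_le_sum hnn (Finset.mem_univ i))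
          rw [Set.indicator_of_mem hi, Pi.one_apply]
          have h1 := hprod _ fun i => L.resampleProb_mem_Icc hξ z ω i
          have h2 := hprod _ fun i => rpow_mem_Icc hξ (L.exponent_nonneg z i)
          rw [idealTransition, abs_le]
          constructor <;> linarith [h1.1, h1.2, h2.1, h2.2]
        · have h0 : ∏ i, L.moveProb z z' i (L.resampleProb ξ z ω i)
              = L.idealTransition ξ z z' :=
            Finset.prod_congr rfl fun i _ => by
              rw [L.resampleProb_eq hξ z ω i (not_le.1 fun hi => h ⟨i, hi⟩)]
          rw [h0, sub_self, abs_zero]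
          exact Finset.sum_nonneg hnn
    _ ≤ _ := by
        rw [Finset.sum_comm]
        exact Finset.sum_le_sum fun i _ =>
          sum_sampleProb_indicator_le hα hT z.strategy_mem_stdSimplex i

theorem tendsto_transition_sub_idealTransition_div [Nonempty I] [∀ i, Nontrivial (A i)]
    (z z' : State u σ M) :
    Tendsto (fun ξ : ℝ => (L.transition ξ z z' - L.idealTransition ξ z z') / ξ ^ L.cost z)
      (𝓝[>] 0) (𝓝 0) := by
  have hpos := sub_pos.2 (L.cost_lt_ubar z)
  have h0 := (tendsto_rpow_nhdsGT_zero hpos.le).const_mul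
    (∑ i : I, (Fintype.card (Σ j : {j // j ≠ i}, A j) : ℝ))
  rw [Real.zero_rpow hpos.ne', mul_zero] at h0
  refine squeeze_zero_norm' ?_ h0
  filter_upwards [Ioo_mem_nhdsGT (zero_lt_one' ℝ)] with ξ hξ
  have hc := Real.rpow_pos_of_pos hξ.1 (L.cost z)
  rw [Real.norm_eq_abs, abs_div, abs_of_pos hc, div_le_iff₀ hc, mul_assoc, ← Real.rpow_add hξ.1,
    sub_add_cancel]
  exact L.abs_transition_sub_idealTransition_le hξ z z'

open Classical in
theorem exists_tendsto_transition_sub_div [Nonempty I] [∀ i, Nontrivial (A i)]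
    (z z' : State u σ M) :
    ∃ l, Tendsto (fun ξ : ℝ => (L.transition ξ z z' - if z = z' then 1 else 0) / ξ ^ L.cost z)
      (𝓝[>] 0) (𝓝 l) := by
  obtain ⟨l, hl⟩ := exists_tendsto_prod_sub_div Finset.univ (L.exponent z) (same z z')
    (fun i => L.γ i * (L.ψ i (z.belief i) (z'.belief i) - same z z' i)) (L.cost_nonneg z)
    (L.cost_le z)
  refine ⟨_, (hl.add (L.tendsto_transition_sub_idealTransition_div z z')).congr fun ξ => ?_⟩
  rw [← add_div, prod_same]
  simp only [idealTransition, moveProb]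
  ring

/-- Gives strict positivity of limiting rates from bounds on the ideal chain, whose difference from
the true one vanishes at this scale. -/
theorem le_of_tendsto_transition [Nonempty I] [∀ i, Nontrivial (A i)] {z z' : State u σ M}
    {l κ : ℝ} (hl : Tendsto (fun ξ : ℝ => L.transition ξ z z' / ξ ^ L.cost z) (𝓝[>] 0) (𝓝 l))
    (hκ : ∀ ξ ∈ Set.Ioo (0 : ℝ) 1, κ * ξ ^ L.cost z ≤ L.idealTransition ξ z z') : κ ≤ l := by
  have h := hl.sub (L.tendsto_transition_sub_idealTransition_div z z')
  rw [sub_zero] at h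
  refine ge_of_tendsto h ?_
  filter_upwards [Ioo_mem_nhdsGT (zero_lt_one' ℝ)] with ξ hξ
  have hc := Real.rpow_pos_of_pos hξ.1 (L.cost z)
  rw [← sub_div, sub_sub_cancel, le_div_iff₀ hc]
  exact hκ ξ hξ

end

/-- From each state the deviation of a single player leads to a state in which all players are
inconsistent. -/
theorem exists_destabilized (hbad : HasDestabilizingBeliefs u σ τ M) (z : State u σ M) (i : I) :
    ∃ d : State u σ M, (∀ j, j ≠ i → d.belief j = z.belief j) ∧
      ∀ j, τ < profileDist (d.belief j).vec (d.others j) := by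
  obtain ⟨c, hc, hc'⟩ := hbad i fun j => z.belief j
  refine ⟨State.ofBelief u σ (Function.update z.belief i c), fun j hj => ?_, fun j => ?_⟩
  · exact Function.update_of_ne hj _ _
  · by_cases hj : j = i
    · subst hj
      have h1 : (State.ofBelief u σ (Function.update z.belief j c)).others j
          = fun k : {k // k ≠ j} => smoothBR u σ (k : I) (z.belief k).vec := by
        funext k
        simp only [State.others, State.ofBelief, Function.update_of_ne k.2]
      rw [h1]
      simpa [State.ofBelief] using hc
    -- The strategy of i alone, one block of the concatenated vector, already puts j at distance
    -- more than τ.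
    · refine (hc' ⟨j, hj⟩).trans_le ?_
      have h1 : (State.ofBelief u σ (Function.update z.belief i c)).others j ⟨i, Ne.symm hj⟩
          = smoothBR u σ i c.vec := by
        simp [State.others, State.ofBelief]
      have h2 : (State.ofBelief u σ (Function.update z.belief i c)).belief j = z.belief j :=
        Function.update_of_ne hj _ _
      rw [← h1, profileDist_comm, h2]
      exact l2Dist_le_profileDist _ (z.belief j).vec ⟨i, Ne.symm hj⟩

/-- The hub of z is the state reached when a player with the least exponent takes a destabilizing
belief and the others keep theirs: the deviation has order ξ^{cost}, the rest is bounded below. At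
the hub all exponents are 0, so every state follows with probability bounded below. -/
theorem exists_tendsto_stationary [Nonempty I] [∀ i, Nonempty (A i)] [Nonempty (State u σ M)]
    (hτ : 0 < τ) (hbad : HasDestabilizingBeliefs u σ τ M) :
    ∃ μ₀ : State u σ M → ℝ,
      (∀ z, Tendsto (fun ξ => L.stationary ξ z) (𝓝[>] 0) (𝓝 (μ₀ z))) ∧
      ∀ z, 0 < μ₀ z ↔ ∀ z', L.cost z' ≤ L.cost z := by
  classical
  have : ∀ i, Nontrivial (A i) := hbad.nontrivial hτ (Classical.arbitrary (State u σ M))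
  choose G hG using L.exists_tendsto_transition_sub_div
  have hG' : ∀ z z', z ≠ z' →
      Tendsto (fun ξ : ℝ => L.transition ξ z z' / ξ ^ L.cost z) (𝓝[>] 0) (𝓝 (G z z')) := by
    intro z z' h
    simpa [h] using hG z z'
  have hpos : ∀ᶠ ξ : ℝ in 𝓝[>] 0, ξ ∈ Set.Ioo (0 : ℝ) 1 := Ioo_mem_nhdsGT zero_lt_one
  have hgen : IsGenerator (S := State u σ M) G := by
    refine ⟨fun z z' h => ge_of_tendsto (hG' z z' h) ?_, fun z => ?_⟩
    · filter_upwards [hpos] with ξ hξ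
      exact div_nonneg (L.transition_pos hξ z z').le (Real.rpow_pos_of_pos hξ.1 _).le
    · refine tendsto_nhds_unique (tendsto_finsetSum Finset.univ fun z' _ => hG z z') ?_
      refine tendsto_const_nhds.congr fun ξ => ?_
      rw [← Finset.sum_div, Finset.sum_sub_distrib, L.sum_transition]
      simp
  have hub : HasHubs (S := State u σ M) G := by
    intro z
    obtain ⟨i, hi⟩ := exists_eq_ciInf_of_finite (f := L.exponent z)
    obtain ⟨d, hd, hd'⟩ := exists_destabilized hbad z i
    refine ⟨d, ?_, fun z' hz' => ?_⟩
    · by_cases hzd : z = d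
      · exact Or.inl hzd
      · refine Or.inr (lt_of_lt_of_le ?_ (L.le_of_tendsto_transition
          (κ := L.γ i * L.lam * ∏ j ∈ Finset.univ.erase i, L.lam) (hG' z d hzd) fun ξ hξ => ?_))
        · exact mul_pos (mul_pos (L.γ_pos i) L.lam_pos) (Finset.prod_pos fun _ _ => L.lam_pos)
        · rw [idealTransition, ← Finset.mul_prod_erase _ _ (Finset.mem_univ i)]
          have h1 := L.mul_le_moveProb z d i (rpow_mem_Icc hξ (L.exponent_nonneg z i))
          have h2 : ∏ j ∈ Finset.univ.erase i, L.lam ≤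
              ∏ j ∈ Finset.univ.erase i, L.moveProb z d j (ξ ^ L.exponent z j) :=
            Finset.prod_le_prod (fun _ _ => L.lam_pos.le) fun j hj =>
              L.lam_le_moveProb z d j (rpow_mem_Icc hξ (L.exponent_nonneg z j))
                (hd j (Finset.ne_of_mem_erase hj))
          have h3 := mul_le_mul h1 h2 (Finset.prod_nonneg fun _ _ => L.lam_pos.le)
            (L.moveProb_mem_Icc z d i (rpow_mem_Icc hξ (L.exponent_nonneg z i))).1
          refine le_trans (le_of_eq ?_) h3
          rw [hi, cost]
          ring
    · have hexp : ∀ j, L.exponent d j = 0 := fun j => if_neg (not_le.2 (hd' j))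
      have hcost : L.cost d = 0 := by simp [cost, hexp]
      refine lt_of_lt_of_le ?_ (L.le_of_tendsto_transition
          (κ := ∏ j, (1 * L.γ j * L.lam)) (hG' d z' (Ne.symm hz')) fun ξ hξ => ?_)
      · exact Finset.prod_pos fun j _ => mul_pos (mul_pos one_pos (L.γ_pos j)) L.lam_pos
      · rw [hcost, Real.rpow_zero, mul_one, idealTransition]
        refine Finset.prod_le_prod (fun j _ => ?_) fun j _ => ?_
        · exact (mul_pos (mul_pos one_pos (L.γ_pos j)) L.lam_pos).le
        · rw [hexp, Real.rpow_zero]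
          exact L.mul_le_moveProb d z' j (by simp)
  refine exists_tendsto_isStationary hgen hub hG ?_
  -- For ξ in (0, 1) a stationary distribution exists, so the default value 0 of `stationary` plays
  -- no role in the limit.
  filter_upwards [hpos] with ξ hξ
  have h := (existsUnique_isStationary (L.transition_pos hξ) (L.sum_transition ξ)).exists
  rw [stationary, dif_pos h]
  exact h.choose_spec

end LearningRule

end HypothesisTesting

/-! ### Existence of consistent states -/

namespace HypothesisTesting

/-- Every probability vector is within `1 / M` of a discretized one. -/
theorem exists_discreteSimplex_near {α : Type*} [Fintype α] {M : ℕ} (hM : 0 < M) {p : α → ℝ}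
    (hp : p ∈ stdSimplex ℝ α) : ∃ q : DiscreteSimplex α M, ∀ a, |q.1 a - p a| ≤ 1 / M := by
  classical
  have hM' : (0 : ℝ) < M := by exact_mod_cast hM
  set k : α → ℕ := fun a => ⌊M * p a⌋₊
  have hk1 : ∀ a, (k a : ℝ) ≤ M * p a := fun a =>
    Nat.floor_le (mul_nonneg hM'.le (hp.1 a))
  have hk2 : ∀ a, M * p a < k a + 1 := fun a => Nat.lt_floor_add_one _
  have hsum : ∑ a, (M : ℝ) * p a = M := by rw [← Finset.mul_sum, hp.2, mul_one]
  have hle : ∑ a, k a ≤ M := by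
    have : (∑ a, (k a : ℝ)) ≤ M := (Finset.sum_le_sum fun a _ => hk1 a).trans_eq hsum
    exact_mod_cast this
  have hcard : M - ∑ a, k a ≤ (Finset.univ : Finset α).card := by
    have : (M : ℝ) ≤ ∑ a, ((k a : ℝ) + 1) :=
      hsum.symm.trans_le (Finset.sum_le_sum fun a _ => (hk2 a).le)
    have h2 : M ≤ ∑ a, (k a + 1) := by exact_mod_cast this
    rw [Finset.sum_add_distrib, Finset.sum_const, smul_eq_mul, mul_one] at h2
    omega
  -- Rounding M p down leaves a deficit of at most one unit per coordinate, so raising some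
  -- coordinates by one restores the sum M.
  obtain ⟨s, -, hs⟩ := Finset.exists_subset_card_eq hcard
  set m : α → ℕ := fun a => k a + if a ∈ s then 1 else 0 with hm
  have hmsum : ∑ a, m a = M := by
    simp only [hm, Finset.sum_add_distrib]
    rw [Finset.sum_ite_mem, Finset.univ_inter, Finset.sum_const, smul_eq_mul, mul_one, hs]
    omega
  refine ⟨⟨fun a => (m a : ℝ) / M, ⟨fun a => by positivity, ?_⟩, fun a => ⟨m a, ?_, rfl⟩⟩,
    fun a => ?_⟩
  · rw [← Finset.sum_div, ← Nat.cast_sum, hmsum, div_self hM'.ne']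
  · rw [← hmsum]
    exact Finset.single_le_sum (f := m) (fun _ _ => Nat.zero_le _) (Finset.mem_univ a)
  · have h1 : (m a : ℝ) / M - p a = (m a - M * p a) / M := by field_simp
    rw [h1, abs_div, abs_of_pos hM', div_le_div_iff_of_pos_right hM', abs_le]
    have h3 : (k a : ℝ) ≤ m a := by exact_mod_cast Nat.le_add_right _ _
    have h4 : (m a : ℝ) ≤ k a + 1 := by
      simp only [hm]
      split_ifs <;> simp
    constructor <;> linarith [hk1 a, hk2 a]

/-! ### Lipschitz bounds for the logit map -/

section Softmax

variable {α : Type*} [Fintype α] [Nonempty α]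

/-- Numerator and denominator each change by a factor of at most e^δ, so the weight for y is at
least e^{-2δ} ≥ 1 - 2δ times that for x. A bound relative to the weight sums to a constant
independent of the number of actions. -/
theorem softmax_sub_le {x y : α → ℝ} {δ : ℝ} (h : ∀ a, |x a - y a| ≤ δ) (a : α) :
    Real.exp (x a) / ∑ b, Real.exp (x b) - Real.exp (y a) / ∑ b, Real.exp (y b)
      ≤ 2 * δ * (Real.exp (x a) / ∑ b, Real.exp (x b)) := by
  set X := ∑ b, Real.exp (x b)
  set Y := ∑ b, Real.exp (y b)
  have hX : 0 < X := Finset.sum_pos (fun _ _ => Real.exp_pos _) Finset.univ_nonempty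
  have hY : 0 < Y := Finset.sum_pos (fun _ _ => Real.exp_pos _) Finset.univ_nonempty
  have h1 : Real.exp (-δ) * Real.exp (x a) ≤ Real.exp (y a) := by
    rw [← Real.exp_add, Real.exp_le_exp]
    linarith [(abs_le.1 (h a)).2]
  have h2 : Y ≤ Real.exp δ * X := by
    rw [Finset.mul_sum]
    refine Finset.sum_le_sum fun b _ => ?_
    rw [← Real.exp_add, Real.exp_le_exp]
    linarith [(abs_le.1 (h b)).1]
  have h3 : Real.exp (-(2 * δ)) * (Real.exp (x a) / X) ≤ Real.exp (y a) / Y := by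
    calc Real.exp (-(2 * δ)) * (Real.exp (x a) / X)
        = Real.exp (-δ) * Real.exp (x a) / (Real.exp δ * X) := by
          rw [show -(2 * δ) = -δ - δ by ring, Real.exp_sub]
          field_simp
      _ ≤ Real.exp (y a) / Y := div_le_div₀ (Real.exp_pos _).le h1 hY h2
  have h4 := Real.add_one_le_exp (-(2 * δ))
  have h5 : 0 ≤ Real.exp (x a) / X := div_nonneg (Real.exp_pos _).le hX.le
  nlinarith

theorem sum_abs_softmax_sub_le {x y : α → ℝ} {δ : ℝ} (h : ∀ a, |x a - y a| ≤ δ) :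
    ∑ a, |Real.exp (x a) / ∑ b, Real.exp (x b) - Real.exp (y a) / ∑ b, Real.exp (y b)|
      ≤ 4 * δ := by
  have hδ : 0 ≤ δ := (abs_nonneg _).trans (h (Classical.arbitrary α))
  have hone : ∀ z : α → ℝ, ∑ a, Real.exp (z a) / ∑ b, Real.exp (z b) = 1 := fun z => by
    rw [← Finset.sum_div]
    exact div_self (Finset.sum_pos (fun _ _ => Real.exp_pos _) Finset.univ_nonempty).ne'
  have hnn : ∀ (z : α → ℝ) a, 0 ≤ Real.exp (z a) / ∑ b, Real.exp (z b) := fun z a => by positivity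
  calc _ ≤ ∑ a, 2 * δ * (Real.exp (x a) / ∑ b, Real.exp (x b) +
        Real.exp (y a) / ∑ b, Real.exp (y b)) := by
        refine Finset.sum_le_sum fun a _ => ?_
        have h1 := softmax_sub_le h a
        have h2 := softmax_sub_le (fun b => (abs_sub_comm (y b) (x b)).trans_le (h b)) a
        have h3 := mul_nonneg hδ (hnn x a)
        have h4 := mul_nonneg hδ (hnn y a)
        rw [abs_le]
        constructor <;> linarith
    _ = 4 * δ := by
        rw [← Finset.mul_sum, Finset.sum_add_distrib, hone, hone]
        ring

end Softmax

/-! ### Total variation distance of product distributions -/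

section Product

variable {κ : Type*} [Fintype κ] [DecidableEq κ] {B : κ → Type*} [∀ k, Fintype (B k)]

theorem sum_abs_prod_update_sub {h : ∀ k, B k → ℝ} (hh : ∀ k, h k ∈ stdSimplex ℝ (B k)) (k : κ)
    (p q : B k → ℝ) :
    ∑ c : (∀ k, B k), |∏ l, Function.update h k p l (c l) - ∏ l, Function.update h k q l (c l)|
      = ∑ x, |p x - q x| := by
  have h1 : ∀ (r : B k → ℝ) (c : ∀ k, B k), ∏ l, Function.update h k r l (c l)
      = r (c k) * ∏ l ∈ Finset.univ.erase k, h l (c l) := by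
    intro r c
    rw [← Finset.mul_prod_erase _ _ (Finset.mem_univ k), Function.update_self]
    congr 1
    exact Finset.prod_congr rfl fun l hl => by
      rw [Function.update_of_ne (Finset.ne_of_mem_erase hl)]
  have h2 : ∀ c : (∀ k, B k),
      |∏ l, Function.update h k p l (c l) - ∏ l, Function.update h k q l (c l)|
        = ∏ l, Function.update h k (fun x => |p x - q x|) l (c l) := by
    intro c
    rw [h1, h1, h1, ← sub_mul, abs_mul,
      abs_of_nonneg (Finset.prod_nonneg fun l _ => (hh l).1 _)]
  have h3 := Finset.prod_univ_sum (fun l => (Finset.univ : Finset (B l)))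
    fun l x => Function.update h k (fun x => |p x - q x|) l x
  rw [Fintype.piFinset_univ] at h3
  rw [Finset.sum_congr rfl fun c _ => h2 c, ← h3, Finset.prod_eq_single k]
  · simp
  · intro l _ hl
    rw [Function.update_of_ne hl]
    exact (hh l).2
  · simp

/-- The total variation distance of product distributions is at most the sum of the total
variation distances of the factors. -/
theorem sum_abs_prod_sub_le {p q : ∀ k, B k → ℝ} (hp : ∀ k, p k ∈ stdSimplex ℝ (B k))
    (hq : ∀ k, q k ∈ stdSimplex ℝ (B k)) :
    ∑ c : (∀ k, B k), |∏ k, p k (c k) - ∏ k, q k (c k)| ≤ ∑ k, ∑ x, |p k x - q k x| := by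
  -- Hybrid argument: q is turned into p one factor at a time, and the unchanged factors sum to 1.
  have key : ∀ s : Finset κ, ∑ c : (∀ k, B k),
      |∏ k, s.piecewise p q k (c k) - ∏ k, q k (c k)| ≤ ∑ k ∈ s, ∑ x, |p k x - q k x| := by
    intro s
    induction s using Finset.induction with
    | empty => simp
    | insert k s hk ih =>
      have hmem : ∀ l, s.piecewise p q l ∈ stdSimplex ℝ (B l) := fun l => by
        by_cases hl : l ∈ s <;> simp [hl, hp, hq]
      have h1 := sum_abs_prod_update_sub hmem k (p k) (q k)
      have h2 : Function.update (s.piecewise p q) k (q k) = s.piecewise p q := by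
        rw [Function.update_eq_self_iff, Finset.piecewise_eq_of_notMem _ _ _ hk]
      rw [h2, ← Finset.piecewise_insert] at h1
      rw [Finset.sum_insert hk, ← h1]
      refine le_trans ?_ (add_le_add_right ih _)
      rw [← Finset.sum_add_distrib]
      exact Finset.sum_le_sum fun c _ => abs_sub_le _ _ _
  simpa using key Finset.univ

end Product

theorem abs_le_maxPayoff {I : Type*} [Fintype I] {A : I → Type*} [∀ i, Fintype (A i)]
    (u : I → (∀ j, A j) → ℝ) (i : I) (a : ∀ j, A j) :
    |u i a| ≤ maxPayoff u :=
  (le_ciSup (f := fun a => |u i a|) (Set.finite_range _).bddAbove a).trans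
    (le_ciSup (f := fun i => ⨆ a, |u i a|) (Set.finite_range _).bddAbove i)

variable {I : Type*} [Fintype I] [DecidableEq I] {A : I → Type*} [∀ i, Fintype (A i)]
  {u : I → (∀ j, A j) → ℝ} {σ τ : ℝ} {M : ℕ}

theorem abs_actionUtility_sub_le (u : I → (∀ j, A j) → ℝ) (i : I) (x : A i)
    {p q : ∀ j : {j // j ≠ i}, A j → ℝ} (hp : ∀ j : {j // j ≠ i}, p j ∈ stdSimplex ℝ (A j))
    (hq : ∀ j : {j // j ≠ i}, q j ∈ stdSimplex ℝ (A j)) :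
    |actionUtility u i x p - actionUtility u i x q| ≤
      maxPayoff u * ∑ j, ∑ y, |p j y - q j y| := by
  rw [actionUtility, actionUtility, ← Finset.sum_sub_distrib]
  have hu : 0 ≤ maxPayoff u := Real.iSup_nonneg fun i => Real.iSup_nonneg fun a => abs_nonneg _
  refine (Finset.abs_sum_le_sum_abs _ _).trans (le_trans ?_
    (mul_le_mul_of_nonneg_left (sum_abs_prod_sub_le hp hq) hu))
  rw [Finset.mul_sum]
  refine Finset.sum_le_sum fun c _ => ?_
  rw [← mul_sub, abs_mul]
  exact mul_le_mul_of_nonneg_right (abs_le_maxPayoff u i _) (abs_nonneg _)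

theorem sum_abs_smoothBR_sub_le (u : I → (∀ j, A j) → ℝ) (hσ : 0 < σ) (i : I) [Nonempty (A i)]
    {p q : ∀ j : {j // j ≠ i}, A j → ℝ} (hp : ∀ j : {j // j ≠ i}, p j ∈ stdSimplex ℝ (A j))
    (hq : ∀ j : {j // j ≠ i}, q j ∈ stdSimplex ℝ (A j)) :
    ∑ x, |smoothBR u σ i p x - smoothBR u σ i q x| ≤
      4 * (1 / σ * (maxPayoff u * ∑ j, ∑ y, |p j y - q j y|)) := by
  refine sum_abs_softmax_sub_le (x := fun x => 1 / σ * actionUtility u i x p)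
    (y := fun x => 1 / σ * actionUtility u i x q) fun x => ?_
  rw [← mul_sub, abs_mul, abs_of_pos (one_div_pos.2 hσ)]
  exact mul_le_mul_of_nonneg_left (abs_actionUtility_sub_le u i x hp hq) (one_div_pos.2 hσ).le

/-- **Logit equilibria exist.** -/
theorem exists_logit_equilibrium [∀ i, Nonempty (A i)] (u : I → (∀ j, A j) → ℝ) (σ : ℝ) :
    ∃ π : ∀ i, A i → ℝ, ∀ i, smoothBR u σ i (fun j => π j) = π i := by
  -- The logit formula is smooth on the whole space with values in [0, 1], so the fixed point
  -- theorem for bounded maps applies and the domain need not be restricted to simplices.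
  set F : EuclideanSpace ℝ (Σ i, A i) → EuclideanSpace ℝ (Σ i, A i) := fun x =>
    WithLp.toLp 2 fun k => smoothBR u σ k.1 (fun j y => x ⟨j, y⟩) k.2 with hF
  have hFc : ContDiff ℝ 1 F := by
    rw [contDiff_euclidean]
    intro k
    simp only [hF, smoothBR, actionUtility]
    refine ContDiff.div ?_ ?_ fun x => ?_
    · fun_prop
    · fun_prop
    · exact (Finset.sum_pos (fun _ _ => Real.exp_pos _) Finset.univ_nonempty).ne'
  obtain ⟨x, hx⟩ := exists_fixedPoint_of_contDiff hFc
    (C := √(∑ _k : (Σ i, A i), (1 : ℝ))) (fun x => by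
      rw [EuclideanSpace.norm_eq]
      refine Real.sqrt_le_sqrt (Finset.sum_le_sum fun k _ => ?_)
      have h1 := smoothBR_mem_stdSimplex u σ k.1 fun j y => x ⟨j, y⟩
      have h2 := h1.1 k.2
      have h3 : smoothBR u σ k.1 (fun j y => x ⟨j, y⟩) k.2 ≤ 1 := by
        rw [← h1.2]
        exact Finset.single_le_sum (fun y _ => h1.1 y) (Finset.mem_univ _)
      rw [Real.norm_eq_abs, sq_abs]
      exact pow_le_one₀ h2 h3)
  refine ⟨fun i y => x ⟨i, y⟩, fun i => funext fun y => ?_⟩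
  exact congrArg (fun w : EuclideanSpace ℝ (Σ i, A i) => w ⟨i, y⟩) hx

/-- All players hold the rounded logit equilibrium as belief. The distance of beliefs from play is
at most the rounding error plus the change in the responses that it causes, and `le_M` bounds the
total by τ. -/
theorem consistentStates_nonempty [∀ i, Nonempty (A i)] {ε : ℝ} (hσ : 0 < σ) (hτ : 0 < τ)
    (hM : 0 < M) (hsmall : SmallParameters u ε σ τ M)
    (hbad : HasDestabilizingBeliefs u σ τ M) : (consistentStates u σ τ M).Nonempty := by
  obtain ⟨π, hπ⟩ := exists_logit_equilibrium u σ
  have hπs : ∀ i, π i ∈ stdSimplex ℝ (A i) := fun i => by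
    rw [← hπ i]
    exact smoothBR_mem_stdSimplex u σ i _
  choose q hq using fun i => exists_discreteSimplex_near hM (hπs i)
  set z : State u σ M := State.ofBelief u σ fun i j => q j
  have hnt := hbad.nontrivial hτ z
  have hM' : (0 : ℝ) < M := by exact_mod_cast hM
  set m : ℝ := (maxActions A : ℝ) with hm
  set n : ℝ := (Fintype.card I : ℝ)
  have hopp : ∀ i, (Fintype.card {j // j ≠ i} : ℝ) ≤ n := fun i => by
    have h : Fintype.card {j // j ≠ i} ≤ Fintype.card I := Fintype.card_subtype_le _
    exact Nat.cast_le.2 h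
  have hu : 0 ≤ maxPayoff u := Real.iSup_nonneg fun i => Real.iSup_nonneg fun a => abs_nonneg _
  have hrow : ∀ j, ∑ x, |(q j).1 x - π j x| ≤ m / M := by
    intro j
    calc ∑ x, |(q j).1 x - π j x| ≤ ∑ _x : A j, (1 : ℝ) / M :=
          Finset.sum_le_sum fun x _ => hq j x
      _ = (Fintype.card (A j) : ℝ) / M := by
          rw [Finset.sum_const, nsmul_eq_mul, Finset.card_univ, mul_one_div]
      _ ≤ m / M := by
          refine div_le_div_of_nonneg_right ?_ hM'.le
          rw [hm]
          exact_mod_cast Finset.le_sup (f := fun i => Fintype.card (A i)) (Finset.mem_univ j)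
  have hm0 : 0 ≤ m / M := by positivity
  have hdist : ∀ i : I, ∑ j : {j // j ≠ i}, ∑ x, |(q j).1 x - π j x| ≤ n * (m / M) := by
    intro i
    refine (Finset.sum_le_sum fun (j : {j // j ≠ i}) _ => hrow j).trans ?_
    rw [Finset.sum_const, nsmul_eq_mul, Finset.card_univ]
    exact mul_le_mul_of_nonneg_right (hopp i) hm0
  refine ⟨z, fun i => ?_⟩
  -- The constant 4 of the softmax bound is absorbed by N: i and some opponent have at least two
  -- actions each.
  have hN : (4 : ℝ) ≤ maxProfiles A := by
    obtain ⟨j⟩ := hbad.nonempty_ne hτ z i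
    have h1 : 2 ≤ Fintype.card (A i) := Fintype.one_lt_card
    have : Nontrivial (∀ j : {j // j ≠ i}, A j) := Pi.nontrivial_at j
    have h2 : 2 ≤ oppActions A i := Fintype.one_lt_card
    have h3 := Finset.le_sup (f := fun i => Fintype.card (A i) * oppActions A i)
      (Finset.mem_univ i)
    have h4 : 4 ≤ maxProfiles A := le_trans (Nat.mul_le_mul h1 h2) h3
    exact_mod_cast h4
  have hm1 : 1 ≤ √m := by
    rw [Real.one_le_sqrt]
    have h1 : Fintype.card (A i) ≤ maxActions A :=
      Finset.le_sup (f := fun i => Fintype.card (A i)) (Finset.mem_univ i)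
    have h2 : 0 < Fintype.card (A i) := Fintype.card_pos
    have h3 : 1 ≤ maxActions A := by omega
    rw [hm]
    exact_mod_cast h3
  have hbr : ∀ j : I, ∑ x, |π j x - smoothBR u σ j (z.belief j).vec x| ≤
      4 * (1 / σ * (maxPayoff u * (n * (m / M)))) := by
    intro j
    have h := sum_abs_smoothBR_sub_le u hσ j (p := (z.belief j).vec) (q := fun k => π k)
      (fun k => (q k).2.1) fun k => hπs k
    rw [hπ j] at h
    simp only [abs_sub_comm (π j _)]
    refine h.trans ?_
    have := hdist j
    gcongr
    exact this
  have hfirst : profileDist (z.belief i).vec (fun j : {j // j ≠ i} => π j) ≤ n * (m / M) :=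
    (profileDist_le_sum _ _).trans (hdist i)
  have hsecond : profileDist (fun j : {j // j ≠ i} => π j) (z.others i) ≤
      n * (4 * (1 / σ * (maxPayoff u * (n * (m / M))))) := by
    refine (profileDist_le_sum _ _).trans ((Finset.sum_le_sum
      fun (j : {j // j ≠ i}) _ => hbr j).trans ?_)
    rw [Finset.sum_const, nsmul_eq_mul, Finset.card_univ]
    exact mul_le_mul_of_nonneg_right (hopp i) (by positivity)
  have hle := hsmall.le_M
  rw [div_mul_eq_mul_div, div_le_iff₀ hτ] at hle
  have hkey : n * m * (1 + 1 / σ * maxPayoff u * 4 * n) ≤ M * τ := by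
    refine le_trans ?_ hle
    have hc : 1 / σ * maxPayoff u * 4 * n ≤ √m / σ * maxPayoff u * maxProfiles A * n := by
      gcongr
    exact mul_le_mul_of_nonneg_left (by linarith) (by positivity)
  calc profileDist (z.belief i).vec (z.others i)
      ≤ n * (m / M) + n * (4 * (1 / σ * (maxPayoff u * (n * (m / M))))) :=
        (profileDist_triangle _ _ _).trans (add_le_add hfirst hsecond)
    _ = n * m * (1 + 1 / σ * maxPayoff u * 4 * n) / M := by ring
    _ ≤ τ := by rwa [div_le_iff₀ hM', mul_comm τ]

end HypothesisTesting

/-! ### Stochastically stable states -/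

namespace HypothesisTesting

variable {I : Type*} [Fintype I] [DecidableEq I] {A : I → Type*} [∀ i, Fintype (A i)]
  {u : I → (∀ j, A j) → ℝ} {σ τ : ℝ} {M : ℕ}

theorem State.utility_mem_Icc (z : State u σ M) (i : I) :
    z.utility i ∈ Set.Icc (minUtilityOf u σ M i) (maxUtilityOf u σ M i) :=
  ⟨ciInf_le (f := fun z : State u σ M => z.utility i) (Set.finite_range _).bddBelow z,
    le_ciSup (f := fun z : State u σ M => z.utility i) (Set.finite_range _).bddAbove z⟩

theorem State.utility_mem_Icc_iInf_iSup (z : State u σ M) (i : I) :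
    z.utility i ∈ Set.Icc (⨅ k, minUtilityOf u σ M k) (⨆ k, maxUtilityOf u σ M k) :=
  ⟨(ciInf_le (Set.finite_range _).bddBelow i).trans (z.utility_mem_Icc i).1,
    (z.utility_mem_Icc i).2.trans (le_ciSup (Set.finite_range _).bddAbove i)⟩

namespace LearningRule

variable (L : LearningRule u σ τ M)

theorem cost_of_mem_consistentStates {z : State u σ M} (hz : z ∈ consistentStates u σ τ M) :
    L.cost z = ⨅ i, L.f i (z.utility i) :=
  iInf_congr fun i => if_pos (hz i)

variable [Nonempty I]

theorem cost_pos_iff (z : State u σ M) : 0 < L.cost z ↔ z ∈ consistentStates u σ τ M := by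
  constructor
  · intro h i
    by_contra hi
    have := L.cost_le z i
    rw [exponent, if_neg hi] at this
    linarith
  · intro hz
    obtain ⟨i, hi⟩ := exists_eq_ciInf_of_finite (f := fun i => L.f i (z.utility i))
    rw [L.cost_of_mem_consistentStates hz, ← hi]
    exact L.f_pos _ _

/-- Inconsistent states cost 0 and consistent ones more, so one consistent state suffices to confine
the maximizers. -/
theorem forall_cost_le_iff (hne : (consistentStates u σ τ M).Nonempty) (z : State u σ M) :
    (∀ z', L.cost z' ≤ L.cost z) ↔ z ∈ consistentStates u σ τ M ∧
      IsMaxOn L.cost (consistentStates u σ τ M) z := by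
  constructor
  · intro h
    obtain ⟨z', hz'⟩ := hne
    exact ⟨(L.cost_pos_iff z).1 (((L.cost_pos_iff z').2 hz').trans_le (h z')), fun w _ => h w⟩
  · rintro ⟨hz, hmax⟩ z'
    by_cases hz' : z' ∈ consistentStates u σ τ M
    · exact hmax hz'
    · exact (not_lt.1 (mt (L.cost_pos_iff z').1 hz')).trans (L.cost_nonneg z)

/-- The cost of a consistent state if all players have the same transformation. -/
theorem cost_eq_of_common (hf : ∀ i j, ∀ x ∈ Set.Icc (⨅ k, minUtilityOf u σ M k)
      (⨆ k, maxUtilityOf u σ M k), L.f i x = L.f j x) (i₀ : I) {z : State u σ M}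
    (hz : z ∈ consistentStates u σ τ M) : L.cost z = L.f i₀ z.minUtility := by
  rw [L.cost_of_mem_consistentStates hz]
  obtain ⟨i, hi⟩ := exists_eq_ciInf_of_finite (f := fun i => z.utility i)
  have hi' : z.minUtility = z.utility i := hi.symm
  have hfi : ∀ j, L.f j (z.utility j) = L.f i₀ (z.utility j) := fun j =>
    hf j i₀ _ (z.utility_mem_Icc_iInf_iSup j)
  refine le_antisymm ?_ (le_ciInf fun j => ?_)
  · rw [hi', ← hfi]
    exact ciInf_le (Set.finite_range _).bddBelow i
  · rw [hfi]
    exact (L.f_strictMono i₀).monotone (ciInf_le (Set.finite_range _).bddBelow j)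

/-- The cost of a consistent state if player `k` has the lowest transformed utility. -/
theorem cost_eq_of_lowest {k : I} (hk : ∀ j, j ≠ k →
      ∀ x ∈ Set.Icc (minUtilityOf u σ M k) (maxUtilityOf u σ M k),
        ∀ y ∈ Set.Icc (minUtilityOf u σ M j) (maxUtilityOf u σ M j), L.f k x ≤ L.f j y)
    {z : State u σ M} (hz : z ∈ consistentStates u σ τ M) :
    L.cost z = L.f k (z.utility k) := by
  rw [L.cost_of_mem_consistentStates hz]
  refine le_antisymm (ciInf_le (Set.finite_range _).bddBelow k) (le_ciInf fun j => ?_)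
  by_cases hj : j = k
  · rw [hj]
  · exact hk j hj _ (z.utility_mem_Icc k) _ (z.utility_mem_Icc j)

theorem mem_stableStates_iff [∀ i, Nonempty (A i)] (hτ : 0 < τ)
    (hbad : HasDestabilizingBeliefs u σ τ M) (hne : (consistentStates u σ τ M).Nonempty)
    {z : State u σ M} : z ∈ L.stableStates ↔ z ∈ consistentStates u σ τ M ∧
      IsMaxOn L.cost (consistentStates u σ τ M) z := by
  have : Nonempty (State u σ M) := ⟨hne.some⟩
  obtain ⟨μ₀, hlim, hpos⟩ := L.exists_tendsto_stationary hτ hbad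
  rw [← L.forall_cost_le_iff hne, ← hpos]
  constructor
  · rintro ⟨l, hl, hl'⟩
    rwa [tendsto_nhds_unique (hlim z) hl']
  · exact fun h => ⟨μ₀ z, h, hlim z⟩

/-- A strictly increasing g does not change maximizers, so both cases reduce to a formula for the
cost on consistent states. -/
theorem stableStates_eq_of_cost_eq [∀ i, Nonempty (A i)] (hτ : 0 < τ)
    (hbad : HasDestabilizingBeliefs u σ τ M) (hne : (consistentStates u σ τ M).Nonempty)
    {g : ℝ → ℝ} (hg : StrictMono g) {v : State u σ M → ℝ}
    (hv : ∀ z ∈ consistentStates u σ τ M, L.cost z = g (v z)) :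
    L.stableStates = {z | z ∈ consistentStates u σ τ M ∧
      IsMaxOn v (consistentStates u σ τ M) z} := by
  ext z
  rw [L.mem_stableStates_iff hτ hbad hne]
  refine and_congr_right fun hz => forall₂_congr fun w hw => ?_
  show L.cost w ≤ L.cost z ↔ v w ≤ v z
  rw [hv z hz, hv w hw, hg.le_iff_le]

end LearningRule

end HypothesisTesting

theorem corollary1 {I : Type*} [Fintype I] [DecidableEq I] [Nonempty I]
    {A : I → Type*} [∀ i, Fintype (A i)] [∀ i, Nonempty (A i)]
    (u : I → (∀ j, A j) → ℝ) (ε σ τ : ℝ) (hε : 0 < ε) (hσ : 0 < σ) (hτ : 0 < τ)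
    (M : ℕ) (hM : 0 < M)
    (hsmall : SmallParameters u ε σ τ M)
    (hbad : HasDestabilizingBeliefs u σ τ M)
    (L : LearningRule u σ τ M) :
    -- the stationary distributions and their limits are well defined
    (∀ ξ ∈ Set.Ioo (0 : ℝ) 1, ∃! μ, IsStationary (L.transition ξ) μ) ∧
    (∀ z, ∃ l : ℝ, Tendsto (fun ξ => L.stationary ξ z) (𝓝[>] 0) (𝓝 l)) ∧
    -- (i) a common transformation
    ((∀ i j, ∀ x ∈ Set.Icc (⨅ k, minUtilityOf u σ M k) (⨆ k, maxUtilityOf u σ M k),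
        L.f i x = L.f j x) →
      L.stableStates = {z | z ∈ consistentStates u σ τ M ∧
        IsMaxOn (fun z' => z'.minUtility) (consistentStates u σ τ M) z}) ∧
    -- (ii) a player whose transformed utility is always the lowest
    (∀ k : I,
      (∀ j, j ≠ k → ∀ x ∈ Set.Icc (minUtilityOf u σ M k) (maxUtilityOf u σ M k),
        ∀ y ∈ Set.Icc (minUtilityOf u σ M j) (maxUtilityOf u σ M j), L.f k x ≤ L.f j y) →
      L.stableStates = {z | z ∈ consistentStates u σ τ M ∧
        IsMaxOn (fun z' => z'.utility k) (consistentStates u σ τ M) z}) := by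
  have hne := consistentStates_nonempty hσ hτ hM hsmall hbad
  have : Nonempty (State u σ M) := ⟨hne.some⟩
  refine ⟨fun ξ hξ => existsUnique_isStationary (L.transition_pos hξ) (L.sum_transition ξ), ?_,
    fun hf => ?_, fun k hk => ?_⟩
  · obtain ⟨μ₀, hlim, -⟩ := L.exists_tendsto_stationary hτ hbad
    exact fun z => ⟨μ₀ z, hlim z⟩
  · exact L.stableStates_eq_of_cost_eq hτ hbad hne (L.f_strictMono (Classical.arbitrary I))
      fun z hz => L.cost_eq_of_common hf _ hz
  · exact L.stableStates_eq_of_cost_eq hτ hbad hne (L.f_strictMono k)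
      fun z hz => L.cost_eq_of_lowest hk hz
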